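/- **Proposition (K-theory of the Penrose tiling algebra).** Let $d_1=d'_1=1$, $d_{n+1}=d_n+d'_n$, $d'_{n+1}=d_n$ for $n\ge 1$, and let $A_n=M_{d_n}(\mathbb C)\oplus M_{d'_n}(\mathbb C)$, with the unital embeddings $$I_n: A_n\to A_{n+1},\qquad (A,B)\mapsto\left(\begin{pmatrix}A&0\\0&B\end{pmatrix},\,A\right),$$ whose matrix of multiplicities is $T=\begin{pmatrix}1&1\\1&0\end{pmatrix}$. Let $A_{PT}$, the algebra of the Penrose tiling, be the AF algebra that is the $C^*$-algebraic inductive limit of $(A_n,I_n)_{n\ge1}$ (the norm completion of $\bigcup_n A_n$). Let $V(A_{PT})$ be the abelian monoid of Murray–von Neumann equivalence classes of projectors in $\bigcup_k M_k(A_{PT})$, with $[p]+[q]=[p\oplus q]$, let $K_0(A_{PT})$ be its Grothendieck group, and let $K_{0+}(A_{PT})$ be the image of $V(A_{PT})$ in $K_0(A_{PT})$. Then $$K_0(A_{PT})=\mathbb Z\oplus\mathbb Z,\qquad K_{0+}(A_{PT})=\left\{(a,b)\in\mathbb Z\oplus\mathbb Z:\ \tfrac{1+\sqrt5}{2}\,a+b\ge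 0\right\}.$$ That is, there is an isomorphism of groups $K_0(A_{PT})\to\mathbb Z\oplus\mathbb Z$ which sends the classes of the images in $A_{PT}$ of the projectors $(1,0)$ and $(0,1)$ of $A_1=\mathbb C\oplus\mathbb C$ to $(1,0)$ and $(0,1)$ respectively, and which maps $K_{0+}(A_{PT})$ onto the displayed set. -/

import Mathlib

open scoped Matrix

noncomputable section

/-! ### The K-group of a unital C*-algebra -/

/-- A projector (self-adjoint idempotent matrix) of arbitrary finite size over `A`, i.e. a projector
in some `M_n(A)`. -/
structure MatProj (A : Type*) [Ring A] [StarRing A] where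
  /-- the number of rows and columns -/
  size : ℕ
  /-- the underlying matrix -/
  mat : Matrix (Fin size) (Fin size) A
  isProj : IsStarProjection mat

namespace MatProj

variable {A B : Type*} [Ring A] [StarRing A] [Ring B] [StarRing B]

/-- Murray--von Neumann equivalence of projectors `p ∈ M_n(A)`, `q ∈ M_m(A)`, regarded in
`M_∞(A)`: `p = u* u` and `q = u u*` for some `u`. Here `u` is taken as an `m × n` matrix: a general
`u ∈ M_∞(A)` may be replaced by `q u p`, which lives in the upper left `m × n` corner. -/
def Equivalent (p q : MatProj A) : Prop :=
  ∃ u : Matrix (Fin q.size) (Fin p.size) A, uᴴ * u = p.mat ∧ u * uᴴ = q.mat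

theorem Equivalent.refl (p : MatProj A) : p.Equivalent p := by
  have h1 : p.matᴴ = p.mat := p.isProj.isSelfAdjoint
  have h2 : p.mat * p.mat = p.mat := p.isProj.isIdempotentElem
  exact ⟨p.mat, by rw [h1, h2], by rw [h1, h2]⟩

theorem Equivalent.symm {p q : MatProj A} (h : p.Equivalent q) : q.Equivalent p := by
  obtain ⟨u, h1, h2⟩ := h
  exact ⟨uᴴ, by simpa using h2, by simpa using h1⟩

theorem Equivalent.trans {p q r : MatProj A} (h : p.Equivalent q) (h' : q.Equivalent r) :
    p.Equivalent r := by
  obtain ⟨u, hu1, hu2⟩ := h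
  obtain ⟨v, hv1, hv2⟩ := h'
  have hp : p.mat * p.mat = p.mat := p.isProj.isIdempotentElem
  have hr : r.mat * r.mat = r.mat := r.isProj.isIdempotentElem
  refine ⟨v * u, ?_, ?_⟩
  · calc (v * u)ᴴ * (v * u) = uᴴ * (vᴴ * v) * u := by
          simp only [Matrix.conjTranspose_mul, Matrix.mul_assoc]
      _ = (uᴴ * u) * (uᴴ * u) := by rw [hv1, ← hu2]; simp only [Matrix.mul_assoc]
      _ = p.mat := by rw [hu1, hp]
  · calc (v * u) * (v * u)ᴴ = v * (u * uᴴ) * vᴴ := by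
          simp only [Matrix.conjTranspose_mul, Matrix.mul_assoc]
      _ = (v * vᴴ) * (v * vᴴ) := by rw [hu2, ← hv1]; simp only [Matrix.mul_assoc]
      _ = r.mat := by rw [hv2, hr]

instance setoid (A : Type*) [Ring A] [StarRing A] : Setoid (MatProj A) where
  r := Equivalent
  iseqv := ⟨Equivalent.refl, Equivalent.symm, Equivalent.trans⟩

/-- Block-diagonal `(m₁ + m₂) × (n₁ + n₂)` matrix with diagonal blocks `a` and `b`. -/
def diag {R : Type*} [Zero R] {m₁ m₂ n₁ n₂ : ℕ} (a : Matrix (Fin m₁) (Fin n₁) R)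
    (b : Matrix (Fin m₂) (Fin n₂) R) : Matrix (Fin (m₁ + m₂)) (Fin (n₁ + n₂)) R :=
  Matrix.reindex finSumFinEquiv finSumFinEquiv (Matrix.fromBlocks a 0 0 b)

theorem diag_mul {R : Type*} [NonUnitalNonAssocSemiring R] {l₁ l₂ m₁ m₂ n₁ n₂ : ℕ}
    (a : Matrix (Fin l₁) (Fin m₁) R) (b : Matrix (Fin l₂) (Fin m₂) R)
    (a' : Matrix (Fin m₁) (Fin n₁) R) (b' : Matrix (Fin m₂) (Fin n₂) R) :
    diag a b * diag a' b' = diag (a * a') (b * b') := by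
  simp [diag, Matrix.submatrix_mul_equiv, Matrix.fromBlocks_multiply]

theorem diag_conjTranspose {R : Type*} [AddMonoid R] [StarAddMonoid R] {m₁ m₂ n₁ n₂ : ℕ}
    (a : Matrix (Fin m₁) (Fin n₁) R) (b : Matrix (Fin m₂) (Fin n₂) R) :
    (diag a b)ᴴ = diag aᴴ bᴴ := by
  simp [diag, Matrix.conjTranspose_submatrix, Matrix.fromBlocks_conjTranspose]

theorem diag_apply {R : Type*} [Zero R] {m₁ m₂ n₁ n₂ : ℕ} (a : Matrix (Fin m₁) (Fin n₁) R)
    (b : Matrix (Fin m₂) (Fin n₂) R) :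
    (∀ i j, diag a b (Fin.castAdd m₂ i) (Fin.castAdd n₂ j) = a i j) ∧
    (∀ i j, diag a b (Fin.castAdd m₂ i) (Fin.natAdd n₁ j) = 0) ∧
    (∀ i j, diag a b (Fin.natAdd m₁ i) (Fin.castAdd n₂ j) = 0) ∧
    (∀ i j, diag a b (Fin.natAdd m₁ i) (Fin.natAdd n₁ j) = b i j) := by
  simp [diag]

theorem diag_assoc {R : Type*} [Zero R] {k m n : ℕ} (a : Matrix (Fin k) (Fin k) R)
    (b : Matrix (Fin m) (Fin m) R) (c : Matrix (Fin n) (Fin n) R) :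
    diag a (diag b c) = Matrix.reindex (finCongr (Nat.add_assoc k m n))
      (finCongr (Nat.add_assoc k m n)) (diag (diag a b) c) := by
  have e1 : ∀ i : Fin k, (finCongr (Nat.add_assoc k m n)).symm (Fin.castAdd (m + n) i) =
      Fin.castAdd n (Fin.castAdd m i) := fun i => by ext; simp
  have e2 : ∀ i : Fin m, (finCongr (Nat.add_assoc k m n)).symm
      (Fin.natAdd k (Fin.castAdd n i)) = Fin.castAdd n (Fin.natAdd k i) := fun i => by ext; simp
  have e3 : ∀ i : Fin n, (finCongr (Nat.add_assoc k m n)).symm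
      (Fin.natAdd k (Fin.natAdd m i)) = Fin.natAdd (k + m) i := fun i => by
    ext; simp [Nat.add_assoc]
  ext i j
  rw [Matrix.reindex_apply, Matrix.submatrix_apply]
  induction i using Fin.addCases with
  | left i =>
    induction j using Fin.addCases with
    | left j => rw [e1, e1]; simp only [diag_apply]
    | right j =>
      induction j using Fin.addCases with
      | left j => rw [e1, e2]; simp only [diag_apply]
      | right j => rw [e1, e3]; simp only [diag_apply]
  | right i =>
    induction i using Fin.addCases with
    | left i =>
      induction j using Fin.addCases with
      | left j => rw [e2, e1]; simp only [diag_apply]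
      | right j =>
        induction j using Fin.addCases with
        | left j => rw [e2, e2]; simp only [diag_apply]
        | right j => rw [e2, e3]; simp only [diag_apply]
    | right i =>
      induction j using Fin.addCases with
      | left j => rw [e3, e1]; simp only [diag_apply]
      | right j =>
        induction j using Fin.addCases with
        | left j => rw [e3, e2]; simp only [diag_apply]
        | right j => rw [e3, e3]; simp only [diag_apply]

theorem diag_zero_right {R : Type*} [Zero R] {n : ℕ} (a : Matrix (Fin n) (Fin n) R)
    (z : Matrix (Fin 0) (Fin 0) R) : diag a z = a := by
  ext i j
  exact (diag_apply a z).1 i j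

theorem diag_comm {R : Type*} [Zero R] {m n : ℕ} (a : Matrix (Fin m) (Fin m) R)
    (b : Matrix (Fin n) (Fin n) R) :
    diag b a = Matrix.reindex ((finSumFinEquiv.symm.trans (Equiv.sumComm _ _)).trans finSumFinEquiv)
      ((finSumFinEquiv.symm.trans (Equiv.sumComm _ _)).trans finSumFinEquiv) (diag a b) := by
  ext i j
  obtain ⟨i, rfl⟩ := finSumFinEquiv.surjective i
  obtain ⟨j, rfl⟩ := finSumFinEquiv.surjective j
  rcases i with i | i <;> rcases j with j | j <;> simp [diag]

/-- The block sum `p ⊕ q` of two projectors. -/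
def sum (p q : MatProj A) : MatProj A where
  size := p.size + q.size
  mat := diag p.mat q.mat
  isProj := by
    have h1 : p.matᴴ = p.mat := p.isProj.isSelfAdjoint
    have h2 : p.mat * p.mat = p.mat := p.isProj.isIdempotentElem
    have h3 : q.matᴴ = q.mat := q.isProj.isSelfAdjoint
    have h4 : q.mat * q.mat = q.mat := q.isProj.isIdempotentElem
    refine ⟨?_, ?_⟩
    · change diag p.mat q.mat * diag p.mat q.mat = _
      rw [diag_mul, h2, h4]
    · change (diag p.mat q.mat)ᴴ = _
      rw [diag_conjTranspose, h1, h3]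

/-- The `0 × 0` projector. -/
def zero : MatProj A := ⟨0, 0, IsStarProjection.zero _⟩

/-- A projector of `A`, regarded as a `1 × 1` matrix. -/
def ofProj (a : A) (ha : IsStarProjection a) : MatProj A where
  size := 1
  mat := Matrix.diagonal fun _ => a
  isProj := by
    have h1 : star a = a := ha.isSelfAdjoint
    have h2 : a * a = a := ha.isIdempotentElem
    refine ⟨?_, ?_⟩
    · change Matrix.diagonal _ * Matrix.diagonal _ = _
      rw [Matrix.diagonal_mul_diagonal, h2]
    · change (Matrix.diagonal _)ᴴ = _
      rw [Matrix.diagonal_conjTranspose]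
      congr 1
      funext _
      exact h1

theorem sum_congr {p p' q q' : MatProj A} (hp : p.Equivalent p') (hq : q.Equivalent q') :
    (p.sum q).Equivalent (p'.sum q') := by
  obtain ⟨u, hu1, hu2⟩ := hp
  obtain ⟨v, hv1, hv2⟩ := hq
  refine ⟨diag u v, ?_, ?_⟩
  · change (diag u v)ᴴ * diag u v = diag p.mat q.mat
    rw [diag_conjTranspose, diag_mul, hu1, hv1]
  · change diag u v * (diag u v)ᴴ = diag p'.mat q'.mat
    rw [diag_conjTranspose, diag_mul, hu2, hv2]

/-- Projectors that differ by a relabelling of the indices are equivalent. -/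
theorem equivalent_of_reindex {p q : MatProj A} (e : Fin p.size ≃ Fin q.size)
    (h : q.mat = Matrix.reindex e e p.mat) : p.Equivalent q := by
  have h1 : p.matᴴ = p.mat := p.isProj.isSelfAdjoint
  have h2 : p.mat * p.mat = p.mat := p.isProj.isIdempotentElem
  refine ⟨p.mat.submatrix e.symm id, ?_, ?_⟩
  · rw [Matrix.conjTranspose_submatrix, Matrix.submatrix_mul_equiv, h1, h2]; rfl
  · rw [Matrix.conjTranspose_submatrix, h, h1]
    have := Matrix.submatrix_mul_equiv p.mat p.mat e.symm (Equiv.refl _) e.symm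
    rw [h2] at this
    exact this

end MatProj

/-- The set `V(A)` of equivalence classes of projectors over `A`. -/
def VMonoid (A : Type*) [Ring A] [StarRing A] : Type _ := Quotient (MatProj.setoid A)

namespace VMonoid

variable {A : Type*} [Ring A] [StarRing A]

/-- The class `[p] ∈ V(A)`. -/
def mk (p : MatProj A) : VMonoid A := Quotient.mk _ p

/-- The neutral element `0 = [0]`. -/
instance : Zero (VMonoid A) := ⟨mk MatProj.zero⟩

/-- The addition `[p] + [q] = [p ⊕ q]`. -/
instance : Add (VMonoid A) :=
  ⟨Quotient.map₂ MatProj.sum fun _ _ h _ _ h' => MatProj.sum_congr h h'⟩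

protected theorem add_comm (x y : VMonoid A) : x + y = y + x := by
  induction x, y using Quotient.inductionOn₂ with | _ p q => ?_
  refine Quotient.sound (MatProj.equivalent_of_reindex
    ((finSumFinEquiv.symm.trans (Equiv.sumComm _ _)).trans finSumFinEquiv) ?_)
  change MatProj.diag q.mat p.mat = Matrix.reindex _ _ (MatProj.diag p.mat q.mat)
  exact MatProj.diag_comm p.mat q.mat

protected theorem add_zero (x : VMonoid A) : x + 0 = x := by
  induction x using Quotient.inductionOn with | _ p => ?_
  refine Quotient.sound (MatProj.equivalent_of_reindex (Equiv.refl _) ?_)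
  exact (MatProj.diag_zero_right p.mat _).symm

instance : AddCommMonoid (VMonoid A) where
  add_assoc x y z := by
    induction x, y, z using Quotient.inductionOn₃ with | _ p q r => ?_
    exact Quotient.sound (MatProj.equivalent_of_reindex (finCongr (Nat.add_assoc _ _ _))
      (MatProj.diag_assoc p.mat q.mat r.mat))
  zero_add x := by rw [VMonoid.add_comm, VMonoid.add_zero]
  add_zero := VMonoid.add_zero
  add_comm := VMonoid.add_comm
  nsmul := nsmulRec

end VMonoid

/-- `K₀(A)`, the enveloping (Grothendieck) group of `V(A)`. -/
abbrev K0 (A : Type*) [Ring A] [StarRing A] : Type _ := Algebra.GrothendieckAddGroup (VMonoid A)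

/-- The class `[p] - [0] ∈ K₀(A)` of a projector `p`. -/
def K0.mk {A : Type*} [Ring A] [StarRing A] (p : MatProj A) : K0 A :=
  Algebra.GrothendieckAddGroup.of (VMonoid.mk p)

/-- `K₀₊(A)`, the image of the canonical map `V(A) → K₀(A)`. -/
def K0Pos (A : Type*) [Ring A] [StarRing A] : Set (K0 A) :=
  Set.range (Algebra.GrothendieckAddGroup.of : VMonoid A →+ K0 A)

/-! ### Inductive limits of sequences of C*-algebras -/

/-- A sequence `A₀ → A₁ → A₂ → ⋯` of unital C*-algebras and injective unital *-morphisms. -/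
structure CStarSequence where
  /-- the algebras `Aₙ` -/
  obj : ℕ → Type
  [cstar : ∀ n, CStarAlgebra (obj n)]
  /-- the morphisms `Iₙ : Aₙ → Aₙ₊₁` -/
  map : ∀ n, obj n →⋆ₐ[ℂ] obj (n + 1)
  injective : ∀ n, Function.Injective (map n)

namespace CStarSequence

attribute [instance] CStarSequence.cstar

variable (S : CStarSequence)

/-- The composite `I_{j-1} ∘ ⋯ ∘ I_i : A_i → A_j`. -/
def trans (i j : ℕ) (h : i ≤ j) : S.obj i →⋆ₐ[ℂ] S.obj j :=
  Nat.leRec (motive := fun j _ => S.obj i →⋆ₐ[ℂ] S.obj j) (StarAlgHom.id ℂ (S.obj i))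
    (fun j _ f => (S.map j).comp f) h

theorem trans_self (i : ℕ) : S.trans i i le_rfl = StarAlgHom.id ℂ (S.obj i) :=
  Nat.leRec_self _ _

theorem trans_succ (i j : ℕ) (h : i ≤ j) :
    S.trans i (j + 1) (Nat.le_succ_of_le h) = (S.map j).comp (S.trans i j h) :=
  Nat.leRec_succ _ _ _

theorem trans_trans {i j k : ℕ} (hij : i ≤ j) (hjk : j ≤ k) (x : S.obj i) :
    S.trans j k hjk (S.trans i j hij x) = S.trans i k (hij.trans hjk) x := by
  induction k, hjk using Nat.le_induction with
  | base => rw [trans_self]; rfl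
  | succ k hk ih => rw [trans_succ S j k hk, trans_succ S i k (hij.trans hk)]; simp [ih]

theorem trans_injective (i j : ℕ) (h : i ≤ j) : Function.Injective (S.trans i j h) := by
  induction j, h using Nat.le_induction with
  | base => rw [trans_self]; exact fun _ _ h => h
  | succ k hk ih => rw [trans_succ S i k hk]; exact (S.injective k).comp ih

theorem norm_trans (i j : ℕ) (h : i ≤ j) (x : S.obj i) : ‖S.trans i j h x‖ = ‖x‖ :=
  NonUnitalStarAlgHom.norm_map _ (S.trans_injective i j h) x

instance : DirectedSystem S.obj (fun i j h => S.trans i j h) where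
  map_self i x := by rw [trans_self]; rfl
  map_map _ _ _ hij hjk x := S.trans_trans hij hjk x

/-- The union `⋃ₙ Aₙ`: the *-algebra of eventually coherent sequences, modulo eventual equality. -/
def Union : Type := DirectLimit S.obj S.trans

namespace Union

instance : Ring S.Union := inferInstanceAs (Ring (DirectLimit S.obj S.trans))
instance : StarRing S.Union := inferInstanceAs (StarRing (DirectLimit S.obj S.trans))
instance : Algebra ℂ S.Union := inferInstanceAs (Algebra ℂ (DirectLimit S.obj S.trans))
instance : StarModule ℂ S.Union := inferInstanceAs (StarModule ℂ (DirectLimit S.obj S.trans))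

variable {S}

/-- The canonical map `Aₙ → ⋃ₙ Aₙ`. -/
def of (n : ℕ) : S.obj n →⋆ₐ[ℂ] S.Union where
  toFun x := (⟦⟨n, x⟩⟧ : DirectLimit S.obj S.trans)
  map_one' := (DirectLimit.one_def n).symm
  map_mul' _ _ := (DirectLimit.mul_def ..).symm
  map_zero' := (DirectLimit.zero_def n).symm
  map_add' _ _ := (DirectLimit.add_def ..).symm
  commutes' r := (DirectLimit.algebraMap_def n r).symm
  map_star' _ := rfl

theorem exists_of (x : S.Union) : ∃ n a, of n a = x := by
  obtain ⟨n, a, h⟩ := DirectLimit.exists_eq_mk S.trans x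
  exact ⟨n, a, h.symm⟩

theorem exists_of₂ (x y : S.Union) : ∃ n a b, of n a = x ∧ of n b = y := by
  obtain ⟨n, a, b, h, h'⟩ := DirectLimit.exists_eq_mk₂ S.trans x y
  exact ⟨n, a, b, h.symm, h'.symm⟩

theorem of_map (n : ℕ) (a : S.obj n) : of (n + 1) (S.map n a) = of n a := by
  have h : S.map n a = S.trans n (n + 1) (Nat.le_succ n) a := by
    rw [trans_succ S n n le_rfl, trans_self]; rfl
  rw [h]
  exact DirectLimit.mk_apply n (n + 1) a (Nat.le_succ n)

/-- The norm on the union, which is `‖a‖` on the class of `a ∈ Aₙ` (the maps are isometric). -/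
instance : Norm S.Union where
  norm := DirectLimit.lift S.trans (fun _ a => ‖a‖) (fun i j h a => (S.norm_trans i j h a).symm)

theorem norm_of (n : ℕ) (a : S.obj n) : ‖of n a‖ = ‖a‖ := rfl

theorem normedSpaceCore : NormedSpace.Core ℂ S.Union where
  norm_nonneg x := by
    obtain ⟨n, a, rfl⟩ := exists_of x
    exact norm_nonneg a
  norm_smul c x := by
    obtain ⟨n, a, rfl⟩ := exists_of x
    rw [← map_smul, norm_of, norm_of, norm_smul]
  norm_triangle x y := by
    obtain ⟨n, a, b, rfl, rfl⟩ := exists_of₂ x y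
    rw [← map_add, norm_of, norm_of, norm_of]
    exact norm_add_le a b
  norm_eq_zero_iff x := by
    obtain ⟨n, a, rfl⟩ := exists_of x
    refine ⟨fun h => ?_, fun h => ?_⟩
    · rw [norm_of, norm_eq_zero] at h
      rw [h, map_zero]
    · obtain ⟨j, h1, h2, h3⟩ := Quotient.exact
        (h.trans (map_zero (of n)).symm : (⟦⟨n, a⟩⟧ : DirectLimit S.obj S.trans) = ⟦⟨n, 0⟩⟧)
      have h4 : a = 0 := S.trans_injective n j h1 h3
      rw [h4, norm_of, norm_zero]

instance : NormedAddCommGroup S.Union := NormedAddCommGroup.ofCore normedSpaceCore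

instance : NormedRing S.Union where
  __ := (inferInstance : NormedAddCommGroup S.Union)
  __ := (inferInstance : Ring S.Union)
  norm_mul_le x y := by
    obtain ⟨n, a, b, rfl, rfl⟩ := exists_of₂ x y
    rw [← map_mul, norm_of, norm_of, norm_of]
    exact norm_mul_le a b

instance : NormedAlgebra ℂ S.Union where
  norm_smul_le c x := (normedSpaceCore.norm_smul c x).le

instance : CStarRing S.Union where
  norm_mul_self_le x := by
    obtain ⟨n, a, rfl⟩ := exists_of x
    rw [← map_star, ← map_mul, norm_of, norm_of]
    exact CStarRing.norm_mul_self_le a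

end Union

/-- The inductive limit of the sequence in the category of C*-algebras: the norm completion of the
union `⋃ₙ Aₙ`. -/
def Limit : Type := UniformSpace.Completion S.Union

namespace Limit

open UniformSpace

instance : NormedRing S.Limit := inferInstanceAs (NormedRing (Completion S.Union))
instance : CompleteSpace S.Limit := inferInstanceAs (CompleteSpace (Completion S.Union))
instance : Algebra ℂ S.Limit := inferInstanceAs (Algebra ℂ (Completion S.Union))

instance : NormedAlgebra ℂ S.Limit where
  norm_smul_le := (inferInstance : NormedSpace ℂ (Completion S.Union)).norm_smul_le

variable {S}

/-- The canonical isometric embedding of the union into its completion. -/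
def coe (x : S.Union) : S.Limit := (x : Completion S.Union)

theorem isometry_coe : Isometry (coe : S.Union → S.Limit) := Completion.coe_isometry

theorem norm_coe (x : S.Union) : ‖coe x‖ = ‖x‖ := Completion.norm_coe x

theorem denseRange_coe : DenseRange (coe : S.Union → S.Limit) := Completion.denseRange_coe

theorem continuous_coe : Continuous (coe : S.Union → S.Limit) := isometry_coe.continuous

theorem coe_add (x y : S.Union) : coe (x + y) = coe x + coe y := Completion.coe_add x y

theorem coe_mul (x y : S.Union) : coe (x * y) = coe x * coe y := Completion.coe_mul x y

theorem coe_smul (c : ℂ) (x : S.Union) : coe (c • x) = c • coe x := Completion.coe_smul c x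

/-- The involution, extended by continuity. -/
instance : Star S.Limit where
  star := Completion.map (star : S.Union → S.Union)

theorem uniformContinuous_star : UniformContinuous (star : S.Union → S.Union) :=
  star_isometry.uniformContinuous

theorem star_coe (x : S.Union) : star (coe x) = coe (star x) :=
  Completion.map_coe uniformContinuous_star x

theorem continuous_star' : Continuous (star : S.Limit → S.Limit) := Completion.continuous_map

instance : StarRing S.Limit where
  star_involutive x := by
    refine denseRange_coe.induction_on (p := fun x : S.Limit => star (star x) = x) x
      (isClosed_eq (continuous_star'.comp continuous_star') continuous_id) fun x => ?_
    rw [star_coe, star_coe, star_star]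
  star_mul x y := by
    refine denseRange_coe.induction_on₂ (p := fun x y : S.Limit => star (x * y) = star y * star x)
      (isClosed_eq (continuous_star'.comp continuous_mul)
        ((continuous_star'.comp continuous_snd).mul (continuous_star'.comp continuous_fst)))
      (fun x y => ?_) x y
    rw [← coe_mul, star_coe, star_coe, star_coe, ← coe_mul, star_mul]
  star_add x y := by
    refine denseRange_coe.induction_on₂ (p := fun x y : S.Limit => star (x + y) = star x + star y)
      (isClosed_eq (continuous_star'.comp continuous_add)
        ((continuous_star'.comp continuous_fst).add (continuous_star'.comp continuous_snd)))
      (fun x y => ?_) x y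
    rw [← coe_add, star_coe, star_coe, star_coe, ← coe_add, star_add]

instance : StarModule ℂ S.Limit where
  star_smul c x := by
    refine denseRange_coe.induction_on (p := fun x : S.Limit => star (c • x) = star c • star x) x
      (isClosed_eq (continuous_star'.comp (continuous_const_smul c))
        (continuous_star'.const_smul (star c))) fun x => ?_
    rw [← coe_smul, star_coe, star_coe, ← coe_smul, star_smul]

instance : CStarRing S.Limit where
  norm_mul_self_le x := by
    refine denseRange_coe.induction_on (p := fun x : S.Limit => ‖x‖ * ‖x‖ ≤ ‖star x * x‖) x
      (isClosed_le (continuous_norm.mul continuous_norm)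
        (continuous_star'.mul continuous_id).norm) fun x => ?_
    rw [star_coe, ← coe_mul, norm_coe, norm_coe]
    exact CStarRing.norm_mul_self_le x

instance : CStarAlgebra S.Limit where

/-- The canonical *-morphism `Aₙ → lim Aₙ`. -/
def of (n : ℕ) : S.obj n →⋆ₐ[ℂ] S.Limit where
  toFun a := coe (Union.of n a)
  map_one' := by rw [map_one]; rfl
  map_mul' a b := by rw [map_mul, coe_mul]
  map_zero' := by rw [map_zero]; rfl
  map_add' a b := by rw [map_add, coe_add]
  commutes' r := by rw [AlgHomClass.commutes]; rfl
  map_star' a := by rw [map_star, star_coe]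

theorem of_map (n : ℕ) (a : S.obj n) : (of (n + 1) (S.map n a) : S.Limit) = of n a :=
  congrArg coe (Union.of_map n a)

theorem norm_of (n : ℕ) (a : S.obj n) : ‖(of n a : S.Limit)‖ = ‖a‖ :=
  norm_coe _

theorem dense_iUnion_range_of : Dense (⋃ n, Set.range (of n : S.obj n → S.Limit)) := by
  refine Dense.mono ?_ (denseRange_coe (S := S))
  rintro _ ⟨x, rfl⟩
  obtain ⟨n, a, rfl⟩ := Union.exists_of x
  exact Set.mem_iUnion.2 ⟨n, a, rfl⟩

end Limit

end CStarSequence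

/-! ### The algebra of the Penrose tiling -/

namespace Penrose

open scoped Matrix.Norms.L2Operator

/-- The dimensions `(dₙ, d'ₙ)`: `(1, 1)`, `(2, 1)`, `(3, 2)`, `(5, 3)`, … -/
def dims : ℕ → ℕ × ℕ
  | 0 => (1, 1)
  | n + 1 => ((dims n).1 + (dims n).2, (dims n).1)

/-- `M_p(ℂ) ⊕ M_q(ℂ)`, with the operator norm on matrices and the maximum norm on the sum. -/
abbrev TwoBlocks (p q : ℕ) : Type := Matrix (Fin p) (Fin p) ℂ × Matrix (Fin q) (Fin q) ℂ

/-- The embedding `(A, B) ↦ (diag(A, B), A)` of `M_p(ℂ) ⊕ M_q(ℂ)` in `M_{p+q}(ℂ) ⊕ M_p(ℂ)`. -/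
def inclusion (p q : ℕ) : TwoBlocks p q →⋆ₐ[ℂ] TwoBlocks (p + q) p where
  toFun x := (MatProj.diag x.1 x.2, x.1)
  map_one' := by
    refine Prod.ext ?_ rfl
    simp [MatProj.diag, Matrix.fromBlocks_one]
  map_mul' x y := by
    refine Prod.ext ?_ rfl
    exact (MatProj.diag_mul _ _ _ _).symm
  map_zero' := by
    refine Prod.ext ?_ rfl
    simp [MatProj.diag, Matrix.fromBlocks_zero]
  map_add' x y := by
    refine Prod.ext ?_ rfl
    ext i j
    obtain ⟨i, rfl⟩ := finSumFinEquiv.surjective i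
    obtain ⟨j, rfl⟩ := finSumFinEquiv.surjective j
    rcases i with i | i <;> rcases j with j | j <;> simp [MatProj.diag]
  commutes' r := by
    refine Prod.ext ?_ rfl
    ext i j
    obtain ⟨i, rfl⟩ := finSumFinEquiv.surjective i
    obtain ⟨j, rfl⟩ := finSumFinEquiv.surjective j
    rcases i with i | i <;> rcases j with j | j <;>
      simp [MatProj.diag, Matrix.algebraMap_matrix_apply, Fin.ext_iff] <;> omega
  map_star' x := by
    refine Prod.ext ?_ rfl
    exact (MatProj.diag_conjTranspose _ _).symm

theorem inclusion_injective (p q : ℕ) : Function.Injective (inclusion p q) := by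
  intro x y h
  have h1 : MatProj.diag x.1 x.2 = MatProj.diag y.1 y.2 := congrArg Prod.fst h
  refine Prod.ext (congrArg Prod.snd h) ?_
  ext i j
  rw [← (MatProj.diag_apply x.1 x.2).2.2.2 i j, h1, (MatProj.diag_apply y.1 y.2).2.2.2 i j]

/-- The sequence `Aₙ = M_{dₙ}(ℂ) ⊕ M_{d'ₙ}(ℂ)` with the embeddings `(A, B) ↦ (diag(A, B), A)`. -/
def sequence : CStarSequence where
  obj n := TwoBlocks (dims n).1 (dims n).2
  map n := inclusion (dims n).1 (dims n).2
  injective _ := inclusion_injective _ _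

/-- The unit `1 ⊕ 0` of the first summand of `A₀ = ℂ ⊕ ℂ`. -/
def firstUnit : sequence.obj 0 := ((1, 0) : TwoBlocks 1 1)

/-- The unit `0 ⊕ 1` of the second summand of `A₀ = ℂ ⊕ ℂ`. -/
def secondUnit : sequence.obj 0 := ((0, 1) : TwoBlocks 1 1)

theorem isStarProjection_units (p q : ℕ) : IsStarProjection ((1, 0) : TwoBlocks p q) ∧
    IsStarProjection ((0, 1) : TwoBlocks p q) := by
  refine ⟨⟨?_, ?_⟩, ⟨?_, ?_⟩⟩ <;>
    simp [IsIdempotentElem, IsSelfAdjoint, Prod.ext_iff]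

theorem isStarProjection_firstUnit : IsStarProjection firstUnit :=
  (isStarProjection_units 1 1).1

theorem isStarProjection_secondUnit : IsStarProjection secondUnit :=
  (isStarProjection_units 1 1).2

end Penrose

/-- The AF algebra of the Penrose tiling, the C*-algebraic inductive limit of the sequence
`M_{dₙ}(ℂ) ⊕ M_{d'ₙ}(ℂ)`. -/
abbrev PenroseAlgebra : Type := Penrose.sequence.Limit

/-- The class in `K₀` of the Penrose algebra of the unit of the first summand of `A₀ = ℂ ⊕ ℂ`. -/
def Penrose.firstClass : K0 PenroseAlgebra :=
  K0.mk (MatProj.ofProj (CStarSequence.Limit.of 0 Penrose.firstUnit)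
    (Penrose.isStarProjection_firstUnit.map _))

/-- The class in `K₀` of the Penrose algebra of the unit of the second summand of `A₀ = ℂ ⊕ ℂ`. -/
def Penrose.secondClass : K0 PenroseAlgebra :=
  K0.mk (MatProj.ofProj (CStarSequence.Limit.of 0 Penrose.secondUnit)
    (Penrose.isStarProjection_secondUnit.map _))

end

/-! Write φ for the golden ratio. The row vector (φ, 1) is a left eigenvector of the multiplicity
matrix for the eigenvalue φ, so the functionals φ⁻ⁿ(φ tr A + tr B) on the algebras `Aₙ` are
compatible. They are also uniformly bounded, so they extend to a trace on the limit
(`Penrose.exists_trace`), and summing diagonal entries gives a morphism from `K0` to ℂ. The proof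
shows that this single number is a complete invariant and determines which values occur.

Completeness: functional calculus makes every projector over the limit equivalent to one over some
`Aₙ` (`Limit.exists_equivalent_map`), where a projector is classified by two ranks r, s
(`equivalent_of_trace_eq`). As φ is irrational, φr + s determines both ranks, so equal traces imply
equivalence (`equivalent_of_trace_limit_eq`). Hence the trace is injective on `K0`.

Values: φ is a unit of ℤ[φ], so traces of projectors are nonnegative elements of ℤ[φ]. Conversely,
if φa + b > 0, then the iterates Tⁿ(a, b) of the multiplicity matrix eventually have nonnegative
entries, because the conjugate eigenvalue has absolute value less than 1
(`exists_goldenRatio_mul_add_eq`); such entries are ranks of a projector over `Aₙ`. The two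
generators have traces φ and 1, so (a, b) corresponds to φa + b. -/

section CStar

/-! ### Perturbation of projections in C*-algebras -/

variable {B C : Type*} [CStarAlgebra B] [CStarAlgebra C]

/-- Two projections at distance less than `1` in a C*-algebra are Murray--von Neumann equivalent. -/
theorem IsStarProjection.exists_star_mul_self_eq_of_norm_sub_lt_one {p q : C}
    (hp : IsStarProjection p) (hq : IsStarProjection q) (hpq : ‖p - q‖ < 1) :
    ∃ u : C, star u * u = p ∧ u * star u = q := by
  have hp1 : p * p = p := hp.isIdempotentElem
  have hq1 : q * q = q := hq.isIdempotentElem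
  have hp2 : star p = p := hp.isSelfAdjoint
  have hq2 : star q = q := hq.isSelfAdjoint
  rcases subsingleton_or_nontrivial C with _ | _
  · exact ⟨0, Subsingleton.elim _ _, Subsingleton.elim _ _⟩
  -- This element commutes with both p and q, and pqp = (1 - e)p, qpq = (1 - e)q. Since ‖e‖ < 1, the
  -- element qp can be normalised to the partial isometry qp(1 - e)^(-1/2).
  set e : C := (p - q) * (p - q) with he
  have hpe : p * e = p - p * q * p := by
    simp only [he, mul_sub, sub_mul, hp1, hq1, ← mul_assoc]
    abel_nf
  have hep : e * p = p - p * q * p := by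
    simp only [he, mul_sub, sub_mul, hp1, hq1, mul_assoc]
    abel
  have hqe : q * e = q - q * p * q := by
    simp only [he, mul_sub, sub_mul, hp1, hq1, ← mul_assoc]
    abel_nf
  have heq : e * q = q - q * p * q := by
    simp only [he, mul_sub, sub_mul, hp1, hq1, mul_assoc]
    abel
  have hesa : IsSelfAdjoint e := by
    simp [he, IsSelfAdjoint, hp2, hq2]
  have hlt : ‖e‖ < 1 := by
    calc ‖e‖ ≤ ‖p - q‖ * ‖p - q‖ := norm_mul_le _ _
      _ < 1 := by nlinarith [norm_nonneg (p - q)]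
  have hspec : ∀ x ∈ spectrum ℝ e, 0 < 1 - x := by
    intro x hx
    have := (le_abs_self x).trans (spectrum.norm_le_norm_of_mem hx)
    linarith
  have hcont : ContinuousOn (fun x : ℝ => (√(1 - x))⁻¹) (spectrum ℝ e) := by
    refine ContinuousOn.inv₀ (by fun_prop) fun x hx => (Real.sqrt_pos.2 (hspec x hx)).ne'
  set h : C := cfc (fun x : ℝ => (√(1 - x))⁻¹) e with hh
  have hhsa : star h = h := (cfc_predicate _ e : IsSelfAdjoint h)
  have hw : h * h * (1 - e) = 1 := by
    have h1 : (1 - e) = cfc (fun x : ℝ => 1 - x) e := by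
      rw [cfc_sub (fun _ => (1 : ℝ)) (fun x => x) e, cfc_const_one ℝ e, cfc_id' ℝ e]
    rw [h1, hh, ← cfc_mul _ _ e hcont hcont, ← cfc_mul (fun x : ℝ => (√(1 - x))⁻¹ * (√(1 - x))⁻¹)
      (fun x => 1 - x) e (hcont.mul hcont) (by fun_prop),
      ← cfc_const_one ℝ e]
    refine cfc_congr fun x hx => ?_
    have h2 := hspec x hx
    have h3 := Real.sq_sqrt h2.le
    have h4 := (Real.sqrt_pos.2 h2).ne'
    field_simp
    exact h3.symm
  have hph : p * h = h * p := by
    have : Commute e p := hep.trans hpe.symm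
    exact (this.cfc_real _).symm
  have hqh : q * h = h * q := by
    have : Commute e q := heq.trans hqe.symm
    exact (this.cfc_real _).symm
  refine ⟨q * p * h, ?_, ?_⟩
  · calc star (q * p * h) * (q * p * h) = h * (p * (q * q) * p) * h := by
          simp only [star_mul, hhsa, hp2, hq2, mul_assoc]
      _ = h * ((1 - e) * p) * h := by rw [hq1, sub_mul, one_mul, hep, sub_sub_cancel]
      _ = h * (p * (1 - e)) * h := by rw [sub_mul 1 e p, mul_sub p 1 e, hep, hpe, one_mul, mul_one]
      _ = p * (h * (1 - e) * h) := by simp only [← mul_assoc, hph]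
      _ = p * (h * h * (1 - e)) := by
        congr 1
        have : Commute e h := (Commute.refl e).cfc_real _ |>.symm
        have h5 : (1 - e) * h = h * (1 - e) := by rw [sub_mul, mul_sub, this.eq, one_mul, mul_one]
        rw [mul_assoc, h5, mul_assoc]
      _ = p := by rw [hw, mul_one]
  · calc q * p * h * star (q * p * h) = q * p * h * h * p * q := by
          simp only [star_mul, hhsa, hp2, hq2, mul_assoc]
      _ = h * h * (q * (p * p) * q) := by
          have h1 : q * p * h = h * (q * p) := by rw [mul_assoc, hph, ← mul_assoc, hqh, mul_assoc]
          rw [h1, mul_assoc h, h1]; simp only [mul_assoc]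
      _ = h * h * (1 - e) * q := by
          rw [hp1, mul_assoc (h * h), sub_mul, heq, one_mul, sub_sub_cancel]
      _ = q := by rw [hw, one_mul]

/-- An almost idempotent self-adjoint element of a C*-algebra is close to a projection. -/
theorem IsSelfAdjoint.exists_isStarProjection_norm_sub_le {a : B} (ha : IsSelfAdjoint a)
    (h : ‖a * a - a‖ < 1 / 8) : ∃ q : B, IsStarProjection q ∧ ‖q - a‖ ≤ 1 / 4 := by
  classical
  have hsp : ∀ x ∈ spectrum ℝ a, |x * x - x| < 1 / 8 := by
    intro x hx
    have h1 : a * a - a = cfc (fun x : ℝ => x * x - x) a := by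
      rw [cfc_sub (fun x : ℝ => x * x) (fun x => x) a, cfc_mul (fun x : ℝ => x) (fun x => x) a,
        cfc_id' ℝ a]
    rw [h1] at h
    exact (norm_apply_le_norm_cfc (fun x : ℝ => x * x - x) a hx).trans_lt h
  have hhalf : ∀ x ∈ spectrum ℝ a, x ≠ 1 / 2 := by
    rintro x hx rfl
    have := hsp _ hx
    norm_num [abs_lt] at this
  -- The spectrum avoids the jump at 1/2, where |x² - x| would be 1/4, so the step function is
  -- continuous on it and yields a spectral projection.
  have hcont : ContinuousOn (fun x : ℝ => if 1 / 2 < x then (1 : ℝ) else 0) (spectrum ℝ a) := by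
    intro x hx
    refine ContinuousAt.continuousWithinAt ?_
    rcases lt_or_gt_of_ne (hhalf x hx) with h1 | h1
    · refine (continuousAt_const (y := (0 : ℝ))).congr ?_
      filter_upwards [eventually_lt_nhds h1] with y hy
      rw [if_neg hy.le.not_gt]
    · refine (continuousAt_const (y := (1 : ℝ))).congr ?_
      filter_upwards [eventually_gt_nhds h1] with y hy
      rw [if_pos hy]
  refine ⟨cfc (fun x : ℝ => if 1 / 2 < x then (1 : ℝ) else 0) a, ⟨?_, cfc_predicate _ a⟩, ?_⟩
  · rw [IsIdempotentElem, ← cfc_mul _ _ a hcont hcont]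
    refine cfc_congr fun x _ => ?_
    split_ifs <;> simp
  · have h1 : cfc (fun x : ℝ => if 1 / 2 < x then (1 : ℝ) else 0) a - a =
        cfc (fun x : ℝ => (if 1 / 2 < x then (1 : ℝ) else 0) - x) a := by
      rw [cfc_sub _ (fun x => x) a hcont, cfc_id' ℝ a]
    rw [h1]
    -- One of |x|, |1 - x| is at least 1/2 and their product is below 1/8, so the other is below
    -- 1/4.
    refine norm_cfc_le (by norm_num) fun x hx => ?_
    have h2 := abs_lt.1 (hsp x hx)
    rw [Real.norm_eq_abs, abs_le]
    split_ifs with h3 <;> constructor <;> nlinarith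

/-- A projection close to the image of an injective *-morphism is equivalent to the image of a
projection. -/
theorem IsStarProjection.exists_equiv_map_of_norm_sub_lt (φ : B →⋆ₐ[ℂ] C)
    (hφ : Function.Injective φ) {p : C} (hp : IsStarProjection p) {b : B}
    (hb : ‖φ b - p‖ < 1 / 32) :
    ∃ q : B, IsStarProjection q ∧ ∃ u : C, star u * u = p ∧ u * star u = φ q := by
  have hp1 : p * p = p := hp.isIdempotentElem
  have hp2 : star p = p := hp.isSelfAdjoint
  have hpn : ‖p‖ ≤ 1 := hp.norm_le
  -- Taking the self-adjoint part costs nothing: p is self-adjoint, so `φ a` is as close to p as `φ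
  -- b` is.
  set a : B := (1 / 2 : ℝ) • (b + star b) with ha
  have hasa : IsSelfAdjoint a := by
    simp [ha, IsSelfAdjoint, add_comm]
  have hap : ‖φ a - p‖ < 1 / 32 := by
    have h1 : φ a - p = (1 / 2 : ℂ) • ((φ b - p) + star (φ b - p)) := by
      have h2 : a = (1 / 2 : ℂ) • (b + star b) := by
        rw [ha, ← Complex.coe_smul]; norm_num
      rw [h2, map_smul, map_add, map_star, star_sub, hp2]
      have h3 : p = (1 / 2 : ℂ) • (p + p) := by
        rw [← two_smul ℂ p, smul_smul]; norm_num
      nth_rw 1 [h3]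
      rw [← smul_sub]
      congr 1
      abel
    rw [h1, norm_smul]
    have h4 : ‖(φ b - p) + star (φ b - p)‖ ≤ ‖φ b - p‖ + ‖φ b - p‖ :=
      (norm_add_le _ _).trans (by rw [norm_star])
    rw [show ‖(1 / 2 : ℂ)‖ = 1 / 2 by norm_num]
    linarith
  -- Injective *-morphisms are isometric, so the estimate can be made in C. With δ = ‖φ a - p‖ the
  -- bound is δ² + 3δ, which is below 1/8 for δ < 1/32.
  have haa : ‖a * a - a‖ < 1 / 8 := by
    rw [← NonUnitalStarAlgHom.norm_map φ hφ, map_sub, map_mul]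
    have h1 : φ a * φ a - φ a = (φ a - p) * (φ a - p) + p * (φ a - p) + (φ a - p) * p
        - (φ a - p) := by
      simp only [mul_sub, sub_mul, hp1]; abel
    rw [h1]
    have h2 := norm_mul_le (φ a - p) (φ a - p)
    have h3 := norm_mul_le p (φ a - p)
    have h4 := norm_mul_le (φ a - p) p
    have h5 := norm_sub_le ((φ a - p) * (φ a - p) + p * (φ a - p) + (φ a - p) * p) (φ a - p)
    have h6 := norm_add₃_le (a := (φ a - p) * (φ a - p)) (b := p * (φ a - p)) (c := (φ a - p) * p)
    nlinarith [norm_nonneg (φ a - p), norm_nonneg p]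
  obtain ⟨q, hq, hqa⟩ := hasa.exists_isStarProjection_norm_sub_le haa
  refine ⟨q, hq, hp.exists_star_mul_self_eq_of_norm_sub_lt_one (hq.map φ) ?_⟩
  have h1 : p - φ q = -(φ a - p) - φ (q - a) := by rw [map_sub]; abel
  have h2 : ‖φ (q - a)‖ ≤ 1 / 4 := by rwa [NonUnitalStarAlgHom.norm_map φ hφ]
  rw [h1]
  refine (norm_sub_le _ _).trans_lt ?_
  rw [norm_neg]
  linarith

end CStar
-- Traces on projectors, on `VMonoid` and on `K0`
noncomputable section

namespace MatProj

section Trace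

variable {A G : Type*} [Ring A] [StarRing A] [AddCommGroup G]

/-- The value of an additive map on the class of a projector, i.e. the sum of its values on the
diagonal. -/
def trace (τ : A →+ G) (p : MatProj A) : G := ∑ i, τ (p.mat i i)

/-- The diagonal sums of uᴴu and uuᴴ run over the same pairs of entries, with the factors swapped; u
may be rectangular. -/
theorem Equivalent.trace_eq {τ : A →+ G} (hτ : ∀ x y, τ (x * y) = τ (y * x)) {p q : MatProj A}
    (h : p.Equivalent q) : p.trace τ = q.trace τ := by
  obtain ⟨u, h1, h2⟩ := h
  simp only [trace, ← h1, ← h2, Matrix.mul_apply, map_sum]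
  rw [Finset.sum_comm]
  exact Finset.sum_congr rfl fun i _ => Finset.sum_congr rfl fun j _ => hτ _ _

theorem trace_sum (τ : A →+ G) (p q : MatProj A) :
    (p.sum q).trace τ = p.trace τ + q.trace τ := by
  refine (Fin.sum_univ_add (a := p.size) (b := q.size)
    (fun i => τ (diag p.mat q.mat i i))).trans ?_
  simp only [diag_apply]
  rfl

end Trace

section Map

variable {A B : Type*} [Ring A] [StarRing A] [Algebra ℂ A] [Ring B] [StarRing B] [Algebra ℂ B]

theorem map_mul_map (φ : A →⋆ₐ[ℂ] B) {k l m : ℕ} (x : Matrix (Fin k) (Fin l) A)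
    (y : Matrix (Fin l) (Fin m) A) : (x * y).map φ = x.map φ * y.map φ := by
  ext i j
  simp [Matrix.mul_apply]

theorem conjTranspose_map' (φ : A →⋆ₐ[ℂ] B) {k l : ℕ} (x : Matrix (Fin k) (Fin l) A) :
    (x.map φ)ᴴ = xᴴ.map φ := by
  ext i j
  simp [map_star]

/-- The image of a projector under a *-morphism. -/
def map (φ : A →⋆ₐ[ℂ] B) (p : MatProj A) : MatProj B where
  size := p.size
  mat := p.mat.map φ
  isProj := by
    have h1 : p.matᴴ = p.mat := p.isProj.isSelfAdjoint
    have h2 : p.mat * p.mat = p.mat := p.isProj.isIdempotentElem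
    refine ⟨?_, ?_⟩
    · change p.mat.map φ * p.mat.map φ = _
      rw [← map_mul_map, h2]
    · change (p.mat.map φ)ᴴ = _
      rw [conjTranspose_map', h1]

theorem Equivalent.map (φ : A →⋆ₐ[ℂ] B) {p q : MatProj A} (h : p.Equivalent q) :
    (p.map φ).Equivalent (q.map φ) := by
  obtain ⟨u, h1, h2⟩ := h
  refine ⟨u.map φ, ?_, ?_⟩
  · calc (u.map φ)ᴴ * u.map φ = (uᴴ * u).map φ := by rw [conjTranspose_map', map_mul_map]
      _ = _ := by rw [h1]; rfl
  · calc u.map φ * (u.map φ)ᴴ = (u * uᴴ).map φ := by rw [conjTranspose_map', map_mul_map]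
      _ = _ := by rw [h2]; rfl

theorem trace_map {G : Type*} [AddCommGroup G] (τ : B →+ G) (φ : A →⋆ₐ[ℂ] B) (p : MatProj A) :
    (p.map φ).trace τ = ∑ i, τ (φ (p.mat i i)) := rfl

end Map

end MatProj

/-- The additive map on `V(A)` induced by a tracial additive map on `A`. -/
def VMonoid.trace {A G : Type*} [Ring A] [StarRing A] [AddCommGroup G] (τ : A →+ G)
    (hτ : ∀ x y, τ (x * y) = τ (y * x)) : VMonoid A →+ G where
  toFun := Quotient.lift (MatProj.trace τ) fun _ _ h => MatProj.Equivalent.trace_eq hτ h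
  map_zero' := Finset.sum_empty
  map_add' x y := by
    induction x, y using Quotient.inductionOn₂ with | _ p q => ?_
    exact MatProj.trace_sum τ p q

/-- The group morphism on `K₀(A)` induced by a tracial additive map on `A`. -/
def K0.trace {A G : Type*} [Ring A] [StarRing A] [AddCommGroup G] (τ : A →+ G)
    (hτ : ∀ x y, τ (x * y) = τ (y * x)) : K0 A →+ G :=
  Algebra.GrothendieckAddGroup.lift (VMonoid.trace τ hτ)

theorem K0.trace_of {A G : Type*} [Ring A] [StarRing A] [AddCommGroup G] (τ : A →+ G)
    (hτ : ∀ x y, τ (x * y) = τ (y * x)) (v : VMonoid A) :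
    K0.trace τ hτ (Algebra.GrothendieckAddGroup.of v) = VMonoid.trace τ hτ v :=
  DFunLike.congr_fun (Algebra.GrothendieckAddGroup.lift.symm_apply_apply (VMonoid.trace τ hτ)) v

theorem K0.trace_mk {A G : Type*} [Ring A] [StarRing A] [AddCommGroup G] (τ : A →+ G)
    (hτ : ∀ x y, τ (x * y) = τ (y * x)) (p : MatProj A) :
    K0.trace τ hτ (K0.mk p) = p.trace τ :=
  K0.trace_of τ hτ _

theorem K0.exists_eq_sub {A : Type*} [Ring A] [StarRing A] (x : K0 A) :
    ∃ p q : MatProj A, x = K0.mk p - K0.mk q := by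
  induction x using AddLocalization.induction_on with
  | H y =>
    obtain ⟨v, w, hw⟩ := y
    obtain ⟨p, rfl⟩ := Quotient.exists_rep v
    obtain ⟨q, rfl⟩ := Quotient.exists_rep w
    refine ⟨p, q, ?_⟩
    rw [eq_sub_iff_add_eq, AddLocalization.mk_eq_addMonoidOf_mk']
    exact ((AddLocalization.addMonoidOf ⊤).mk'_spec (VMonoid.mk p) ⟨VMonoid.mk q, trivial⟩)

/-! ### Projectors over an inductive limit come from a finite stage -/

namespace CStarSequence

variable {S : CStarSequence}

theorem Union.of_trans {i j : ℕ} (h : i ≤ j) (a : S.obj i) :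
    (Union.of j (S.trans i j h a) : S.Union) = Union.of i a := by
  induction j, h using Nat.le_induction with
  | base => rw [trans_self]; rfl
  | succ k hk ih => rw [trans_succ S i k hk]; exact (Union.of_map k _).trans ih

theorem Limit.of_trans {i j : ℕ} (h : i ≤ j) (a : S.obj i) :
    (Limit.of j (S.trans i j h a) : S.Limit) = Limit.of i a :=
  congrArg Limit.coe (Union.of_trans h a)

theorem Union.exists_of_finite {ι : Type*} [Fintype ι] (f : ι → S.Union) :
    ∃ n, ∃ g : ι → S.obj n, ∀ i, Union.of n (g i) = f i := by
  choose m a ha using fun i => Union.exists_of (f i)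
  refine ⟨Finset.univ.sup m, fun i => S.trans (m i) _ (Finset.le_sup (Finset.mem_univ i)) (a i),
    fun i => ?_⟩
  rw [Union.of_trans, ha]

theorem Limit.exists_matrix_norm_sub_lt [PartialOrder S.Limit] [StarOrderedRing S.Limit] {k : ℕ}
    (M : CStarMatrix (Fin k) (Fin k) S.Limit) {ε : ℝ}
    (hε : 0 < ε) : ∃ n, ∃ N : Matrix (Fin k) (Fin k) (S.obj n),
      ‖CStarMatrix.ofMatrix (N.map (Limit.of n)) - M‖ < ε := by
  have hd : DenseRange (fun N : Fin k → Fin k → S.Union => fun i j => Limit.coe (N i j)) :=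
    DenseRange.piMap fun _ => DenseRange.piMap fun _ => Limit.denseRange_coe
  -- The topology of the C*-norm on matrices is the product topology, so entrywise density is
  -- enough; finitely many entries then lie in a common stage.
  have hd' : Dense (X := CStarMatrix (Fin k) (Fin k) S.Limit)
    (Set.range (fun N : Fin k → Fin k → S.Union => fun i j => Limit.coe (N i j))) := hd
  obtain ⟨_, hN, N, rfl⟩ := Metric.dense_iff.1 hd' M ε hε
  obtain ⟨n, g, hg⟩ := Union.exists_of_finite fun x : Fin k × Fin k => N x.1 x.2
  refine ⟨n, Matrix.of fun i j => g (i, j), ?_⟩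
  have h : (CStarMatrix.ofMatrix ((Matrix.of fun i j => g (i, j)).map (Limit.of n)) :
      CStarMatrix (Fin k) (Fin k) S.Limit) = fun i j => Limit.coe (N i j) :=
    funext₂ fun i j => congrArg Limit.coe (hg (i, j))
  rw [← dist_eq_norm, h]
  exact hN

/-- Every projector over the limit is equivalent to the image of a projector over some `Aₙ`. -/
theorem Limit.exists_equivalent_map (p : MatProj S.Limit) :
    ∃ n, ∃ q : MatProj (S.obj n), p.Equivalent (q.map (Limit.of n)) := by
  -- The order only serves to provide the C*-algebra structure on matrices over the limit, in which
  -- the perturbation lemma is applied.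
  let : PartialOrder S.Limit := CStarAlgebra.spectralOrder _
  have : StarOrderedRing S.Limit := CStarAlgebra.spectralOrderedRing _
  obtain ⟨n, N, hN⟩ := Limit.exists_matrix_norm_sub_lt (CStarMatrix.ofMatrix p.mat)
    (show (0 : ℝ) < 1 / 32 by norm_num)
  let : PartialOrder (S.obj n) := CStarAlgebra.spectralOrder _
  have : StarOrderedRing (S.obj n) := CStarAlgebra.spectralOrderedRing _
  let φ : CStarMatrix (Fin p.size) (Fin p.size) (S.obj n) →⋆ₐ[ℂ]
      CStarMatrix (Fin p.size) (Fin p.size) S.Limit :=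
    { toFun := fun M => M.map (Limit.of n)
      map_one' := by
        ext i j
        by_cases h : i = j <;> simp [CStarMatrix.one_apply, h]
      map_mul' := fun M N => MatProj.map_mul_map (Limit.of n) M N
      map_zero' := by ext i j; simp
      map_add' := fun M N => by ext i j; simp
      commutes' := fun r => by
        ext i j
        by_cases h : i = j <;> simp [CStarMatrix.algebraMap_apply, h, AlgHomClass.commutes]
      map_star' := fun M => (MatProj.conjTranspose_map' (Limit.of n) M).symm }
  have hinj : Function.Injective (Limit.of n : S.obj n → S.Limit) := by
    refine (injective_iff_map_eq_zero _).2 fun a ha => ?_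
    rw [← norm_eq_zero, ← Limit.norm_of n a, ha, norm_zero]
  have hφ : Function.Injective φ := CStarMatrix.map_injective hinj
  have hp : IsStarProjection (CStarMatrix.ofMatrix p.mat) := ⟨p.isProj.1, p.isProj.2⟩
  obtain ⟨q, hq, u, hu1, hu2⟩ := hp.exists_equiv_map_of_norm_sub_lt φ hφ
    (b := CStarMatrix.ofMatrix N) hN
  exact ⟨n, ⟨p.size, CStarMatrix.ofMatrix.symm q, ⟨hq.1, hq.2⟩⟩, u, hu1, hu2⟩

end CStarSequence

end
-- Classification of projection matrices by rank
noncomputable section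

namespace Matrix

/-- A projection matrix is of the form `V Vᴴ` with `V` an isometry. -/
theorem exists_isometry_of_isStarProjection {ι : Type*} [Fintype ι] [DecidableEq ι]
    {P : Matrix ι ι ℂ} (hP : IsStarProjection P) :
    ∃ (r : ℕ) (V : Matrix ι (Fin r) ℂ), Vᴴ * V = 1 ∧ V * Vᴴ = P := by
  have hA : P.IsHermitian := hP.isSelfAdjoint
  set U : Matrix ι ι ℂ := (hA.eigenvectorUnitary).1
  have hUU : Uᴴ * U = 1 := Unitary.coe_star_mul_self hA.eigenvectorUnitary
  set d : ι → ℂ := RCLike.ofReal ∘ hA.eigenvalues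
  have hPU : U * diagonal d * Uᴴ = P := hA.spectral_theorem.symm
  -- Conjugating P² = P by U shows that each eigenvalue is 0 or 1.
  have hdd : ∀ i, d i * d i = d i := by
    have h1 : diagonal d = Uᴴ * P * U := by
      rw [← hPU]
      calc diagonal d = (Uᴴ * U) * diagonal d * (Uᴴ * U) := by rw [hUU, one_mul, mul_one]
        _ = _ := by simp only [Matrix.mul_assoc]
    have hUU' : U * Uᴴ = 1 := mul_eq_one_comm.1 hUU
    have hPP : P * P = P := hP.isIdempotentElem
    have h2 : diagonal d * diagonal d = diagonal d := by
      rw [h1]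
      calc Uᴴ * P * U * (Uᴴ * P * U) = Uᴴ * P * (U * Uᴴ) * P * U := by
            simp only [Matrix.mul_assoc]
        _ = Uᴴ * (P * P) * U := by rw [hUU', mul_one, Matrix.mul_assoc Uᴴ]
        _ = _ := by rw [hPP]
    rw [diagonal_mul_diagonal] at h2
    exact fun i => congrFun (diagonal_injective h2) i
  classical
  let e : Fin (Fintype.card {i // d i = 1}) ≃ {i // d i = 1} := (Fintype.equivFin _).symm
  -- The isometry consists of the columns of U with eigenvalue 1.
  refine ⟨_, U.submatrix id fun j => (e j : ι), ?_, ?_⟩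
  · have h1 : (U.submatrix id fun j => (e j : ι))ᴴ * (U.submatrix id fun j => (e j : ι)) =
        (Uᴴ * U).submatrix (fun j => (e j : ι)) (fun j => (e j : ι)) := by
      ext i j; simp [mul_apply]
    rw [h1, hUU]
    exact submatrix_one _ (Subtype.val_injective.comp e.injective)
  · rw [← hPU]
    ext i k
    rw [mul_apply, mul_apply]
    simp only [submatrix_apply, id, conjTranspose_apply, mul_diagonal]
    rw [Equiv.sum_comp e (fun j : {i // d i = 1} => U i j * star (U k j)),
      ← Finset.sum_subtype (Finset.univ.filter fun j => d j = 1) (by simp)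
        (fun j => U i j * star (U k j)), Finset.sum_filter]
    refine Finset.sum_congr rfl fun j _ => ?_
    rcases eq_or_ne (d j) 0 with h0 | h0
    · simp [h0]
    · simp [mul_right_cancel₀ h0 ((hdd j).trans (one_mul _).symm)]

/-- Projection matrices of the same trace are Murray--von Neumann equivalent. -/
theorem exists_conjTranspose_mul_self_eq_of_trace_eq {ι κ : Type*} [Fintype ι] [DecidableEq ι]
    [Fintype κ] [DecidableEq κ] {P : Matrix ι ι ℂ} {Q : Matrix κ κ ℂ} (hP : IsStarProjection P)
    (hQ : IsStarProjection Q) (h : P.trace = Q.trace) :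
    ∃ u : Matrix κ ι ℂ, uᴴ * u = P ∧ u * uᴴ = Q := by
  obtain ⟨r, V, hV1, hV2⟩ := exists_isometry_of_isStarProjection hP
  obtain ⟨s, W, hW1, hW2⟩ := exists_isometry_of_isStarProjection hQ
  -- The trace of VVᴴ counts the columns of V, so both projections factor through the same space and
  -- WVᴴ is the required partial isometry.
  rw [← hV2, ← hW2, trace_mul_comm, hV1, trace_mul_comm, hW1, trace_one, trace_one] at h
  obtain rfl : r = s := by simpa using h
  refine ⟨W * Vᴴ, ?_, ?_⟩
  · calc (W * Vᴴ)ᴴ * (W * Vᴴ) = V * (Wᴴ * W) * Vᴴ := by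
          simp only [conjTranspose_mul, conjTranspose_conjTranspose, Matrix.mul_assoc]
      _ = P := by rw [hW1, Matrix.mul_one, hV2]
  · calc (W * Vᴴ) * (W * Vᴴ)ᴴ = W * (Vᴴ * V) * Wᴴ := by
          simp only [conjTranspose_mul, conjTranspose_conjTranspose, Matrix.mul_assoc]
      _ = Q := by rw [hV1, Matrix.mul_one, hW2]

theorem exists_nat_trace_eq {ι : Type*} [Fintype ι] [DecidableEq ι] {P : Matrix ι ι ℂ}
    (hP : IsStarProjection P) : ∃ r : ℕ, P.trace = r := by
  obtain ⟨r, V, hV1, hV2⟩ := exists_isometry_of_isStarProjection hP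
  exact ⟨r, by rw [← hV2, trace_mul_comm, hV1, trace_one, Fintype.card_fin]⟩

end Matrix

/-! ### Projectors over a sum of two matrix algebras -/

namespace Penrose

open scoped Matrix.Norms.L2Operator

variable {p q : ℕ}

/-- Flatten the first component of a matrix over `M_p(ℂ) ⊕ M_q(ℂ)`. -/
def fstBlock {k l : ℕ} (x : Matrix (Fin k) (Fin l) (TwoBlocks p q)) :
    Matrix (Fin k × Fin p) (Fin l × Fin p) ℂ := Matrix.of fun i j => (x i.1 j.1).1 i.2 j.2

/-- Flatten the second component of a matrix over `M_p(ℂ) ⊕ M_q(ℂ)`. -/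
def sndBlock {k l : ℕ} (x : Matrix (Fin k) (Fin l) (TwoBlocks p q)) :
    Matrix (Fin k × Fin q) (Fin l × Fin q) ℂ := Matrix.of fun i j => (x i.1 j.1).2 i.2 j.2

theorem fstBlock_mul {k l m : ℕ} (x : Matrix (Fin k) (Fin l) (TwoBlocks p q))
    (y : Matrix (Fin l) (Fin m) (TwoBlocks p q)) :
    fstBlock (x * y) = fstBlock x * fstBlock y := by
  ext i j
  simp [fstBlock, Matrix.mul_apply, Prod.fst_sum, Matrix.sum_apply, Fintype.sum_prod_type]

theorem sndBlock_mul {k l m : ℕ} (x : Matrix (Fin k) (Fin l) (TwoBlocks p q))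
    (y : Matrix (Fin l) (Fin m) (TwoBlocks p q)) :
    sndBlock (x * y) = sndBlock x * sndBlock y := by
  ext i j
  simp [sndBlock, Matrix.mul_apply, Prod.snd_sum, Matrix.sum_apply, Fintype.sum_prod_type]

theorem fstBlock_conjTranspose {k l : ℕ} (x : Matrix (Fin k) (Fin l) (TwoBlocks p q)) :
    fstBlock xᴴ = (fstBlock x)ᴴ := by
  ext i j
  simp [fstBlock]

theorem sndBlock_conjTranspose {k l : ℕ} (x : Matrix (Fin k) (Fin l) (TwoBlocks p q)) :
    sndBlock xᴴ = (sndBlock x)ᴴ := by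
  ext i j
  simp [sndBlock]

theorem eq_of_blocks_eq {k l : ℕ} {x y : Matrix (Fin k) (Fin l) (TwoBlocks p q)}
    (h1 : fstBlock x = fstBlock y) (h2 : sndBlock x = sndBlock y) : x = y := by
  ext i j a b
  · exact congrFun₂ h1 (i, a) (j, b)
  · exact congrFun₂ h2 (i, a) (j, b)

theorem isStarProjection_fstBlock (P : MatProj (TwoBlocks p q)) :
    IsStarProjection (fstBlock P.mat) := by
  have h1 : P.matᴴ = P.mat := P.isProj.isSelfAdjoint
  have h2 : P.mat * P.mat = P.mat := P.isProj.isIdempotentElem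
  refine ⟨?_, ?_⟩
  · rw [IsIdempotentElem, ← fstBlock_mul, h2]
  · change (fstBlock P.mat)ᴴ = _
    rw [← fstBlock_conjTranspose, h1]

theorem isStarProjection_sndBlock (P : MatProj (TwoBlocks p q)) :
    IsStarProjection (sndBlock P.mat) := by
  have h1 : P.matᴴ = P.mat := P.isProj.isSelfAdjoint
  have h2 : P.mat * P.mat = P.mat := P.isProj.isIdempotentElem
  refine ⟨?_, ?_⟩
  · rw [IsIdempotentElem, ← sndBlock_mul, h2]
  · change (sndBlock P.mat)ᴴ = _
    rw [← sndBlock_conjTranspose, h1]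

/-- Matrices over M_p ⊕ M_q are pairs of complex matrices, so the two partial isometries can be
chosen independently and reassembled. -/
theorem equivalent_of_trace_eq {P Q : MatProj (TwoBlocks p q)}
    (h1 : (fstBlock P.mat).trace = (fstBlock Q.mat).trace)
    (h2 : (sndBlock P.mat).trace = (sndBlock Q.mat).trace) : P.Equivalent Q := by
  obtain ⟨v, hv1, hv2⟩ := Matrix.exists_conjTranspose_mul_self_eq_of_trace_eq
    (isStarProjection_fstBlock P) (isStarProjection_fstBlock Q) h1
  obtain ⟨w, hw1, hw2⟩ := Matrix.exists_conjTranspose_mul_self_eq_of_trace_eq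
    (isStarProjection_sndBlock P) (isStarProjection_sndBlock Q) h2
  let u : Matrix (Fin Q.size) (Fin P.size) (TwoBlocks p q) := Matrix.of fun i j =>
    (Matrix.of fun a b => v (i, a) (j, b), Matrix.of fun a b => w (i, a) (j, b))
  have hu1 : fstBlock u = v := rfl
  have hu2 : sndBlock u = w := rfl
  refine ⟨u, eq_of_blocks_eq ?_ ?_, eq_of_blocks_eq ?_ ?_⟩
  · rw [fstBlock_mul, fstBlock_conjTranspose, hu1, hv1]
  · rw [sndBlock_mul, sndBlock_conjTranspose, hu2, hw1]
  · rw [fstBlock_mul, fstBlock_conjTranspose, hu1, hv2]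
  · rw [sndBlock_mul, sndBlock_conjTranspose, hu2, hw2]

theorem trace_fstBlock {k : ℕ} (x : Matrix (Fin k) (Fin k) (TwoBlocks p q)) :
    (fstBlock x).trace = ∑ i, (x i i).1.trace := by
  simp [fstBlock, Matrix.trace, Fintype.sum_prod_type]

theorem trace_sndBlock {k : ℕ} (x : Matrix (Fin k) (Fin k) (TwoBlocks p q)) :
    (sndBlock x).trace = ∑ i, (x i i).2.trace := by
  simp [sndBlock, Matrix.trace, Fintype.sum_prod_type]

end Penrose
end
-- The trace on the limit algebra
noncomputable section

namespace CStarSequence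

variable {S : CStarSequence}

/-- A compatible, uniformly bounded family of traces on the algebras `Aₙ` extends to a trace on
the limit. -/
theorem Limit.exists_trace (τ : ∀ n, S.obj n →+ ℂ) (hτ : ∀ n a, τ (n + 1) (S.map n a) = τ n a)
    (hcomm : ∀ n x y, τ n (x * y) = τ n (y * x)) {K : ℝ} (hK : ∀ n a, ‖τ n a‖ ≤ K * ‖a‖) :
    ∃ T : S.Limit →+ ℂ, (∀ x y, T (x * y) = T (y * x)) ∧ ∀ n a, T (Limit.of n a) = τ n a := by
  have hcompat : ∀ i j (h : i ≤ j) (a : S.obj i), τ i a = τ j (S.trans i j h a) := by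
    intro i j h a
    induction j, h using Nat.le_induction with
    | base => rw [trans_self]; rfl
    | succ k hk ih => rw [trans_succ S i k hk]; exact ih.trans (hτ k _).symm
  let t : S.Union → ℂ := DirectLimit.lift S.trans (fun n a => τ n a) hcompat
  have ht : ∀ n a, t (Union.of n a) = τ n a := fun _ _ => rfl
  let t' : S.Union →+ ℂ := AddMonoidHom.mk' t fun x y => by
    obtain ⟨n, a, b, rfl, rfl⟩ := Union.exists_of₂ x y
    rw [← map_add, ht, ht, ht, map_add]
  -- The bound K does not depend on n, so the functional is bounded on the whole union and extends
  -- to its completion.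
  let f : NormedAddGroupHom S.Union ℂ := t'.mkNormedAddGroupHom K fun x => by
    obtain ⟨n, a, rfl⟩ := Union.exists_of x
    exact hK n a
  have hf : ∀ n a, f (Union.of n a) = τ n a := fun _ _ => rfl
  let T : NormedAddGroupHom (UniformSpace.Completion S.Union) ℂ := f.extension
  have hT : ∀ x : S.Union, T (Limit.coe x) = f x := fun x => f.extension_coe x
  have hTc : Continuous (fun x : S.Limit => T x) := T.continuous
  refine ⟨(T.toAddMonoidHom : UniformSpace.Completion S.Union →+ ℂ), fun x y => ?_, fun n a => ?_⟩
  · change T (x * y : S.Limit) = T (y * x : S.Limit)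
    refine Limit.denseRange_coe.induction_on₂
      (p := fun x y : S.Limit => T (x * y : S.Limit) = T (y * x : S.Limit))
      (isClosed_eq (hTc.comp (continuous_fst.mul continuous_snd))
        (hTc.comp (continuous_snd.mul continuous_fst))) (fun x y => ?_) x y
    obtain ⟨n, a, b, rfl, rfl⟩ := Union.exists_of₂ x y
    rw [← Limit.coe_mul, ← Limit.coe_mul, hT, hT, ← map_mul, ← map_mul, hf, hf, hcomm]
  · exact hT _

end CStarSequence

namespace Penrose

open scoped Matrix.Norms.L2Operator
open Real

/-- Each diagonal entry is a coordinate of the image of a unit basis vector, hence is bounded by the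
operator norm. -/
theorem norm_trace_le {m : ℕ} (x : Matrix (Fin m) (Fin m) ℂ) : ‖x.trace‖ ≤ m * ‖x‖ := by
  have h : ∀ i, ‖x i i‖ ≤ ‖x‖ := fun i => by
    have h1 := Matrix.l2_opNorm_mulVec x (EuclideanSpace.single i (1 : ℂ))
    have h2 := (PiLp.norm_apply_le
      (WithLp.toLp 2 (x *ᵥ (EuclideanSpace.single i (1 : ℂ)).ofLp) : EuclideanSpace ℂ (Fin m)) i)
    simp only [PiLp.norm_single, norm_one, mul_one] at h1
    refine le_trans (le_of_eq ?_) (h2.trans h1)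
    simp
  calc ‖x.trace‖ ≤ ∑ i, ‖x i i‖ := norm_sum_le _ _
    _ ≤ ∑ _i : Fin m, ‖x‖ := Finset.sum_le_sum fun i _ => h i
    _ = m * ‖x‖ := by simp

/-- The functional `φ tr A + tr B`. -/
def weightedTrace (p q : ℕ) : TwoBlocks p q →+ ℂ where
  toFun x := (goldenRatio : ℂ) * x.1.trace + x.2.trace
  map_zero' := by simp
  map_add' x y := by simp; ring

theorem weightedTrace_apply {p q : ℕ} (x : TwoBlocks p q) :
    weightedTrace p q x = (goldenRatio : ℂ) * x.1.trace + x.2.trace := rfl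

theorem weightedTrace_mul_comm {p q : ℕ} (x y : TwoBlocks p q) :
    weightedTrace p q (x * y) = weightedTrace p q (y * x) := by
  rw [weightedTrace_apply, weightedTrace_apply, Prod.fst_mul, Prod.fst_mul, Prod.snd_mul,
    Prod.snd_mul, Matrix.trace_mul_comm x.1, Matrix.trace_mul_comm x.2]

theorem goldenRatio_mul_self_complex :
    (goldenRatio : ℂ) * goldenRatio = goldenRatio + 1 := by
  rw [← sq]
  exact_mod_cast goldenRatio_sq

theorem trace_diag {p q : ℕ} (a : Matrix (Fin p) (Fin p) ℂ) (b : Matrix (Fin q) (Fin q) ℂ) :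
    (MatProj.diag a b).trace = a.trace + b.trace := by
  simp [Matrix.trace, Fin.sum_univ_add, MatProj.diag_apply]

/-- The eigenvector property: φ(α + β) + α = φ(φα + β), because φ² = φ + 1. Dividing by φⁿ at stage
n therefore makes the family compatible. -/
theorem weightedTrace_inclusion {p q : ℕ} (x : TwoBlocks p q) :
    weightedTrace (p + q) p (inclusion p q x) = goldenRatio * weightedTrace p q x := by
  change (goldenRatio : ℂ) * (MatProj.diag x.1 x.2).trace + x.1.trace = _
  rw [weightedTrace_apply, trace_diag]
  linear_combination -x.1.trace * goldenRatio_mul_self_complex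

theorem norm_weightedTrace_le {p q : ℕ} (x : TwoBlocks p q) :
    ‖weightedTrace p q x‖ ≤ (goldenRatio * p + q) * ‖x‖ := by
  rw [weightedTrace_apply]
  have h1 := norm_trace_le x.1
  have h2 := norm_trace_le x.2
  have h3 : ‖x.1‖ ≤ ‖x‖ := norm_fst_le x
  have h4 : ‖x.2‖ ≤ ‖x‖ := norm_snd_le x
  have h5 := goldenRatio_pos
  refine (norm_add_le _ _).trans ?_
  rw [norm_mul, Complex.norm_real, Real.norm_of_nonneg h5.le, add_mul, mul_assoc]
  gcongr
  · exact h1.trans (by gcongr)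
  · exact h2.trans (by gcongr)

/-- The same eigenvector relation, applied to the dimensions from (1, 1) on. It shows that the norm
bound, once divided by φⁿ, is φ + 1 at every stage. -/
theorem goldenRatio_mul_dims (n : ℕ) :
    goldenRatio * (dims n).1 + (dims n).2 = goldenRatio ^ n * (goldenRatio + 1) := by
  induction n with
  | zero => simp [dims]
  | succ n ih =>
    simp only [dims, Nat.cast_add]
    rw [pow_succ]
    linear_combination goldenRatio * ih - ((dims n).1 : ℝ) * goldenRatio_sq

/-- The trace of the Penrose algebra. -/
theorem exists_trace : ∃ T : PenroseAlgebra →+ ℂ, (∀ x y, T (x * y) = T (y * x)) ∧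
    ∀ n (a : sequence.obj n), T (CStarSequence.Limit.of n a) =
      ((goldenRatio : ℂ) ^ n)⁻¹ * weightedTrace (dims n).1 (dims n).2 a := by
  have hφ : (goldenRatio : ℂ) ≠ 0 := by exact_mod_cast goldenRatio_ne_zero
  refine CStarSequence.Limit.exists_trace (S := sequence) (K := goldenRatio + 1)
    (fun n => (AddMonoidHom.mulLeft ((goldenRatio : ℂ) ^ n)⁻¹).comp
      (weightedTrace (dims n).1 (dims n).2)) ?_ ?_ ?_
  · intro n a
    change ((goldenRatio : ℂ) ^ (n + 1))⁻¹ * weightedTrace _ _ (inclusion _ _ a) =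
      ((goldenRatio : ℂ) ^ n)⁻¹ * weightedTrace _ _ a
    refine (congrArg _ (weightedTrace_inclusion (p := (dims n).1) (q := (dims n).2) a)).trans ?_
    rw [pow_succ]
    field_simp
  · intro n x y
    exact congrArg (fun z => ((goldenRatio : ℂ) ^ n)⁻¹ * z)
      (weightedTrace_mul_comm (p := (dims n).1) (q := (dims n).2) x y)
  · intro n a
    change ‖((goldenRatio : ℂ) ^ n)⁻¹ * weightedTrace (dims n).1 (dims n).2 a‖ ≤ _
    rw [norm_mul, norm_inv, norm_pow, Complex.norm_real, Real.norm_of_nonneg goldenRatio_pos.le]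
    have h := norm_weightedTrace_le (p := (dims n).1) (q := (dims n).2) a
    rw [goldenRatio_mul_dims] at h
    have h1 : 0 < goldenRatio ^ n := pow_pos goldenRatio_pos n
    rw [inv_mul_le_iff₀ h1, ← mul_assoc]
    exact h

theorem dims_pos (n : ℕ) : 0 < (dims n).1 ∧ 0 < (dims n).2 := by
  induction n with
  | zero => simp [dims]
  | succ n ih => exact ⟨Nat.add_pos_left ih.1 _, ih.1⟩

theorem isStarProjection_single {m : ℕ} (i : Fin m) :
    IsStarProjection (Matrix.single i i (1 : ℂ)) := by
  refine ⟨?_, ?_⟩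
  · simp [IsIdempotentElem]
  · change (Matrix.single i i (1 : ℂ))ᴴ = _
    simp

/-- The summands of `Aₙ` contain projections of rank one. -/
theorem exists_isStarProjection_rank_one {p q : ℕ} (hp : 0 < p) (hq : 0 < q) :
    (∃ a : TwoBlocks p q, IsStarProjection a ∧ weightedTrace p q a = goldenRatio) ∧
      ∃ a : TwoBlocks p q, IsStarProjection a ∧ weightedTrace p q a = 1 := by
  have h1 := isStarProjection_single (⟨0, hp⟩ : Fin p)
  have h2 := isStarProjection_single (⟨0, hq⟩ : Fin q)
  refine ⟨⟨(Matrix.single ⟨0, hp⟩ ⟨0, hp⟩ 1, 0), ⟨Prod.ext h1.1 (mul_zero _),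
      Prod.ext h1.2 (star_zero _)⟩, ?_⟩,
    ⟨(0, Matrix.single ⟨0, hq⟩ ⟨0, hq⟩ 1), ⟨Prod.ext (mul_zero _) h2.1,
      Prod.ext (star_zero _) h2.2⟩, ?_⟩⟩
  · simp [weightedTrace_apply]
  · simp [weightedTrace_apply]

/-! ### Arithmetic of the golden ratio -/

/-- Irrationality of φ is what lets one real number remember two integers. -/
theorem goldenRatio_mul_add_eq_zero {a b : ℤ} (h : goldenRatio * a + b = 0) : a = 0 ∧ b = 0 := by
  have ha : a = 0 := by
    by_contra ha
    have h1 := goldenRatio_irrational.mul_intCast ha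
    refine h1 ⟨-b, ?_⟩
    push_cast
    linarith
  subst ha
  simpa using h

/-- Iterating the multiplicity matrix multiplies φa + b by φ and the conjugate form ψa + b by ψ,
where |ψ| < 1. The positive φ-part eventually dominates and makes both entries nonnegative. -/
theorem exists_goldenRatio_mul_add_eq {a b : ℤ} (h : 0 < goldenRatio * a + b) :
    ∃ n r s : ℕ, goldenRatio * a + b = (goldenRatio ^ n)⁻¹ * (goldenRatio * r + s) := by
  let x : ℕ → ℤ × ℤ := fun n => (fun y : ℤ × ℤ => (y.1 + y.2, y.1))^[n] (a, b)
  have hx0 : x 0 = (a, b) := rfl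
  have hx : ∀ n, x (n + 1) = ((x n).1 + (x n).2, (x n).1) := fun n =>
    Function.iterate_succ_apply' _ n _
  have hrec : ∀ θ : ℝ, θ ^ 2 = θ + 1 → ∀ n, θ * (x n).1 + (x n).2 = θ ^ n * (θ * a + b) := by
    intro θ hθ n
    induction n with
    | zero => simp [hx0]
    | succ n ih =>
      rw [hx, pow_succ]
      push_cast
      linear_combination θ * ih - ((x n).1 : ℝ) * hθ
  have h1 := hrec _ goldenRatio_sq
  have h2 := hrec _ goldenConj_sq
  -- From this N on, φⁿ(φa + b) exceeds |ψa + b|, which bounds the conjugate part for all n.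
  obtain ⟨N, hN⟩ := pow_unbounded_of_one_lt (|goldenConj * a + b| / (goldenRatio * a + b))
    one_lt_goldenRatio
  have hpos : ∀ n, N ≤ n → 0 ≤ (x n).1 := by
    intro n hn
    have h3 : (goldenRatio - goldenConj) * (x n).1 =
        goldenRatio ^ n * (goldenRatio * a + b) - goldenConj ^ n * (goldenConj * a + b) := by
      linear_combination h1 n - h2 n
    have h4 : |goldenConj * a + b| < goldenRatio ^ n * (goldenRatio * a + b) := by
      rw [div_lt_iff₀ h] at hN
      refine hN.trans_le ?_
      gcongr
      exact one_lt_goldenRatio.le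
    have h5 : goldenConj ^ n * (goldenConj * a + b) ≤ |goldenConj * a + b| := by
      refine (le_abs_self _).trans ?_
      rw [abs_mul, abs_pow]
      refine mul_le_of_le_one_left (abs_nonneg _) (pow_le_one₀ (abs_nonneg _) ?_)
      rw [abs_le]
      exact ⟨neg_one_lt_goldenConj.le, goldenConj_neg.le.trans zero_le_one⟩
    have h6 : 0 < goldenRatio - goldenConj := by
      linarith [goldenRatio_pos, goldenConj_neg]
    have h7 : (0 : ℝ) < (x n).1 := by
      refine pos_of_mul_pos_right ?_ h6.le
      rw [h3]; linarith
    exact_mod_cast h7.le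
  -- Stage N + 1 is used because its second entry is the first entry at stage N, so one positivity
  -- statement covers both.
  have hr := hpos (N + 1) (Nat.le_succ N)
  have hs : 0 ≤ (x (N + 1)).2 := by rw [hx]; exact hpos N le_rfl
  obtain ⟨r, hr⟩ := Int.eq_ofNat_of_zero_le hr
  obtain ⟨s, hs⟩ := Int.eq_ofNat_of_zero_le hs
  refine ⟨N + 1, r, s, ?_⟩
  have h8 := h1 (N + 1)
  rw [hr, hs, Int.cast_natCast, Int.cast_natCast] at h8
  rw [h8, inv_mul_cancel_left₀ (pow_ne_zero _ goldenRatio_ne_zero)]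

end Penrose
end
-- The trace as a complete invariant of projectors over the Penrose algebra
noncomputable section

namespace Penrose

open scoped Matrix.Norms.L2Operator
open Real CStarSequence

theorem sum_weightedTrace {p q k : ℕ} (x : Matrix (Fin k) (Fin k) (TwoBlocks p q)) :
    ∑ i, weightedTrace p q (x i i) = goldenRatio * (fstBlock x).trace + (sndBlock x).trace := by
  simp only [trace_fstBlock, trace_sndBlock, weightedTrace_apply]
  rw [Finset.sum_add_distrib, ← Finset.mul_sum]

/-- The value of the trace on the image of a projector over `Aₙ`. -/
theorem trace_map_of {T : PenroseAlgebra →+ ℂ}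
    (hT : ∀ n (a : sequence.obj n), T (Limit.of n a) =
      ((goldenRatio : ℂ) ^ n)⁻¹ * weightedTrace (dims n).1 (dims n).2 a)
    (n : ℕ) (p : MatProj (sequence.obj n)) :
    (p.map (Limit.of n)).trace T = ((goldenRatio : ℂ) ^ n)⁻¹ *
      (goldenRatio * (fstBlock (p := (dims n).1) (q := (dims n).2) p.mat).trace +
        (sndBlock (p := (dims n).1) (q := (dims n).2) p.mat).trace) := by
  rw [MatProj.trace_map]
  simp only [hT]
  rw [← Finset.mul_sum]
  exact congrArg _ (sum_weightedTrace (p := (dims n).1) (q := (dims n).2) p.mat)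

theorem exists_nat_trace_eq (n : ℕ) (p : MatProj (sequence.obj n)) :
    ∃ r s : ℕ, (fstBlock (p := (dims n).1) (q := (dims n).2) p.mat).trace = r ∧
      (sndBlock (p := (dims n).1) (q := (dims n).2) p.mat).trace = s := by
  obtain ⟨r, hr⟩ := Matrix.exists_nat_trace_eq
    (isStarProjection_fstBlock (p := (dims n).1) (q := (dims n).2) p)
  obtain ⟨s, hs⟩ := Matrix.exists_nat_trace_eq
    (isStarProjection_sndBlock (p := (dims n).1) (q := (dims n).2) p)
  exact ⟨r, s, hr, hs⟩

/-- Projectors over the Penrose algebra of the same trace are equivalent. -/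
theorem equivalent_of_trace_limit_eq {T : PenroseAlgebra →+ ℂ}
    (hcomm : ∀ x y, T (x * y) = T (y * x))
    (hT : ∀ n (a : sequence.obj n), T (Limit.of n a) =
      ((goldenRatio : ℂ) ^ n)⁻¹ * weightedTrace (dims n).1 (dims n).2 a)
    {p q : MatProj PenroseAlgebra} (h : p.trace T = q.trace T) : p.Equivalent q := by
  obtain ⟨i, p', hp⟩ := Limit.exists_equivalent_map p
  obtain ⟨j, q', hq⟩ := Limit.exists_equivalent_map q
  -- Ranks can be compared only within one algebra, so both projectors are pushed to a common stage.
  let n := max i j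
  let p'' : MatProj (sequence.obj n) := p'.map (sequence.trans i n (le_max_left i j))
  let q'' : MatProj (sequence.obj n) := q'.map (sequence.trans j n (le_max_right i j))
  have hp' : p.Equivalent (p''.map (Limit.of n)) := by
    refine hp.trans (MatProj.equivalent_of_reindex (Equiv.refl _) ?_)
    ext a b
    exact Limit.of_trans (le_max_left i j) (p'.mat a b)
  have hq' : q.Equivalent (q''.map (Limit.of n)) := by
    refine hq.trans (MatProj.equivalent_of_reindex (Equiv.refl _) ?_)
    ext a b
    exact Limit.of_trans (le_max_right i j) (q'.mat a b)
  refine hp'.trans (MatProj.Equivalent.trans ?_ hq'.symm)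
  refine MatProj.Equivalent.map _ ?_
  rw [hp'.trace_eq hcomm, hq'.trace_eq hcomm, trace_map_of hT, trace_map_of hT] at h
  obtain ⟨r, s, hr, hs⟩ := exists_nat_trace_eq n p''
  obtain ⟨r', s', hr', hs'⟩ := exists_nat_trace_eq n q''
  rw [hr, hs, hr', hs'] at h
  have hφ : (goldenRatio : ℂ) ^ n ≠ 0 := pow_ne_zero _ (by exact_mod_cast goldenRatio_ne_zero)
  have h1 := mul_left_cancel₀ (inv_ne_zero hφ) h
  have h2 : goldenRatio * r + s = goldenRatio * r' + s' := by exact_mod_cast h1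
  -- Equality of the traces now separates into equality of the two ranks.
  have h3 := goldenRatio_mul_add_eq_zero (a := r - r') (b := s - s')
    (by push_cast; linear_combination h2)
  obtain rfl : r = r' := by omega
  obtain rfl : s = s' := by omega
  exact equivalent_of_trace_eq (hr.trans hr'.symm) (hs.trans hs'.symm)

theorem trace_ofProj {A G : Type*} [Ring A] [StarRing A] [AddCommGroup G] (τ : A →+ G) (a : A)
    (ha : IsStarProjection a) : (MatProj.ofProj a ha).trace τ = τ a :=
  (Fin.sum_univ_one (fun i => τ (Matrix.diagonal (fun _ : Fin 1 => a) i i))).trans (by simp)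

/-- The trace is injective on `K₀`. -/
theorem trace_K0_injective {T : PenroseAlgebra →+ ℂ} (hcomm : ∀ x y, T (x * y) = T (y * x))
    (hT : ∀ n (a : sequence.obj n), T (Limit.of n a) =
      ((goldenRatio : ℂ) ^ n)⁻¹ * weightedTrace (dims n).1 (dims n).2 a) :
    Function.Injective (K0.trace T hcomm) := by
  refine (injective_iff_map_eq_zero _).2 fun x hx => ?_
  obtain ⟨p, q, rfl⟩ := K0.exists_eq_sub x
  rw [map_sub, sub_eq_zero, K0.trace_mk, K0.trace_mk] at hx
  rw [sub_eq_zero]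
  exact congrArg Algebra.GrothendieckAddGroup.of
    (Quotient.sound (s := MatProj.setoid _) (equivalent_of_trace_limit_eq hcomm hT hx))

theorem trace_firstClass {T : PenroseAlgebra →+ ℂ} (hcomm : ∀ x y, T (x * y) = T (y * x))
    (hT : ∀ n (a : sequence.obj n), T (Limit.of n a) =
      ((goldenRatio : ℂ) ^ n)⁻¹ * weightedTrace (dims n).1 (dims n).2 a) :
    K0.trace T hcomm firstClass = goldenRatio := by
  rw [firstClass, K0.trace_mk, trace_ofProj, hT, pow_zero, inv_one, one_mul]
  exact show weightedTrace 1 1 (1, 0) = (goldenRatio : ℂ) by simp [weightedTrace_apply]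

theorem trace_secondClass {T : PenroseAlgebra →+ ℂ} (hcomm : ∀ x y, T (x * y) = T (y * x))
    (hT : ∀ n (a : sequence.obj n), T (Limit.of n a) =
      ((goldenRatio : ℂ) ^ n)⁻¹ * weightedTrace (dims n).1 (dims n).2 a) :
    K0.trace T hcomm secondClass = 1 := by
  rw [secondClass, K0.trace_mk, trace_ofProj, hT, pow_zero, inv_one, one_mul]
  exact show weightedTrace 1 1 (0, 1) = (1 : ℂ) by simp [weightedTrace_apply]

/-- The powers of the golden ratio are units of `ℤ[φ]`. -/
theorem exists_int_goldenRatio_pow_inv_mul (n : ℕ) (r s : ℤ) :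
    ∃ a b : ℤ, (goldenRatio ^ n)⁻¹ * (goldenRatio * r + s) = goldenRatio * a + b := by
  induction n generalizing r s with
  | zero => exact ⟨r, s, by simp⟩
  | succ n ih =>
    -- The pair (s, r - s) is the image of (r, s) under the inverse of the multiplicity matrix:
    -- φ⁻¹(φr + s) = φs + (r - s).
    obtain ⟨a, b, h⟩ := ih s (r - s)
    refine ⟨a, b, ?_⟩
    rw [← h, pow_succ, mul_inv, mul_assoc]
    congr 1
    rw [inv_mul_eq_iff_eq_mul₀ goldenRatio_ne_zero]
    push_cast
    linear_combination -(s : ℝ) * goldenRatio_sq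

/-- The traces of projectors over the Penrose algebra are nonnegative elements of `ℤ[φ]`. -/
theorem exists_int_trace_eq {T : PenroseAlgebra →+ ℂ} (hcomm : ∀ x y, T (x * y) = T (y * x))
    (hT : ∀ n (a : sequence.obj n), T (Limit.of n a) =
      ((goldenRatio : ℂ) ^ n)⁻¹ * weightedTrace (dims n).1 (dims n).2 a)
    (p : MatProj PenroseAlgebra) :
    ∃ a b : ℤ, p.trace T = ((goldenRatio * a + b : ℝ) : ℂ) ∧ 0 ≤ goldenRatio * a + b := by
  obtain ⟨n, p', hp⟩ := Limit.exists_equivalent_map p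
  obtain ⟨r, s, hr, hs⟩ := exists_nat_trace_eq n p'
  obtain ⟨a, b, hab⟩ := exists_int_goldenRatio_pow_inv_mul n r s
  refine ⟨a, b, ?_, ?_⟩
  · rw [hp.trace_eq hcomm, trace_map_of hT, hr, hs, ← hab]
    push_cast
    rfl
  · rw [← hab]
    have := goldenRatio_pos
    push_cast
    positivity

/-- Every nonnegative element of `ℤ[φ]` is the trace of a projector. -/
theorem exists_trace_eq {T : PenroseAlgebra →+ ℂ} (hcomm : ∀ x y, T (x * y) = T (y * x))
    (hT : ∀ n (a : sequence.obj n), T (Limit.of n a) =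
      ((goldenRatio : ℂ) ^ n)⁻¹ * weightedTrace (dims n).1 (dims n).2 a)
    {a b : ℤ} (h : 0 ≤ goldenRatio * a + b) :
    ∃ v : VMonoid PenroseAlgebra, VMonoid.trace T hcomm v = ((goldenRatio * a + b : ℝ) : ℂ) := by
  -- The value zero is treated apart, since the domination argument needs φa + b > 0.
  rcases h.eq_or_lt with h | h
  · exact ⟨0, by rw [map_zero, ← h, Complex.ofReal_zero]⟩
  obtain ⟨n, r, s, hrs⟩ := exists_goldenRatio_mul_add_eq h
  obtain ⟨⟨x, hx, hx'⟩, y, hy, hy'⟩ :=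
    exists_isStarProjection_rank_one (dims_pos n).1 (dims_pos n).2
  let X : sequence.obj n := x
  let Y : sequence.obj n := y
  have hX : IsStarProjection X := ⟨hx.1, hx.2⟩
  have hY : IsStarProjection Y := ⟨hy.1, hy.2⟩
  have key : ∀ (Z : sequence.obj n) (hZ : IsStarProjection (Limit.of n Z : PenroseAlgebra)),
      VMonoid.trace T hcomm (VMonoid.mk (MatProj.ofProj _ hZ)) =
        ((goldenRatio : ℂ) ^ n)⁻¹ * weightedTrace (dims n).1 (dims n).2 Z :=
    fun Z hZ => (trace_ofProj T _ hZ).trans (hT n Z)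
  -- Block sums of r and s copies of rank-one projections from the two summands of stage n;
  -- multiples in `VMonoid` impose no limit from the dimensions.
  refine ⟨r • VMonoid.mk (MatProj.ofProj _ (hX.map (Limit.of n))) +
    s • VMonoid.mk (MatProj.ofProj _ (hY.map (Limit.of n))), ?_⟩
  rw [map_add, map_nsmul, map_nsmul, key, key, hrs]
  simp only [X, Y, hx', hy', nsmul_eq_mul]
  push_cast
  ring

end Penrose
end

/-! ### The isomorphism and the positive cone -/

theorem proposition4p7 :
    ∃ e : K0 PenroseAlgebra ≃+ ℤ × ℤ,
      e Penrose.firstClass = (1, 0) ∧ e Penrose.secondClass = (0, 1) ∧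
      e '' K0Pos PenroseAlgebra =
        {x : ℤ × ℤ | 0 ≤ (1 + Real.sqrt 5) / 2 * (x.1 : ℝ) + (x.2 : ℝ)} := by
  obtain ⟨T, hcomm, hT⟩ := Penrose.exists_trace
  -- The inverse isomorphism is the easy one to write down, being fixed by the two generators; the
  -- trace then proves that it is bijective.
  let J : ℤ × ℤ →+ K0 PenroseAlgebra :=
    ((zmultiplesHom _ Penrose.firstClass).coprod (zmultiplesHom _ Penrose.secondClass))
  have hJ : ∀ a b : ℤ, J (a, b) = a • Penrose.firstClass + b • Penrose.secondClass :=
    fun _ _ => rfl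
  have hTJ : ∀ x : ℤ × ℤ, K0.trace T hcomm (J x) =
      ((Real.goldenRatio * x.1 + x.2 : ℝ) : ℂ) := by
    rintro ⟨a, b⟩
    rw [hJ, map_add, map_zsmul, map_zsmul, Penrose.trace_firstClass hcomm hT,
      Penrose.trace_secondClass hcomm hT, zsmul_eq_mul, zsmul_eq_mul]
    push_cast
    ring
  have hinj : Function.Injective J := by
    refine (injective_iff_map_eq_zero _).2 fun x hx => ?_
    have h := hTJ x
    rw [hx, map_zero] at h
    have h1 := Penrose.goldenRatio_mul_add_eq_zero (Complex.ofReal_eq_zero.1 h.symm)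
    exact Prod.ext h1.1 h1.2
  have hmk : ∀ p : MatProj PenroseAlgebra, ∃ x : ℤ × ℤ, J x = K0.mk p ∧
      0 ≤ Real.goldenRatio * x.1 + x.2 := by
    intro p
    obtain ⟨a, b, h, hab⟩ := Penrose.exists_int_trace_eq hcomm hT p
    -- Both classes have trace φa + b, hence coincide in `K0`.
    refine ⟨(a, b), Penrose.trace_K0_injective hcomm hT ?_, hab⟩
    rw [hTJ, K0.trace_mk, h]
  have hsurj : Function.Surjective J := by
    intro y
    obtain ⟨p, q, rfl⟩ := K0.exists_eq_sub y
    obtain ⟨x, hx, -⟩ := hmk p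
    obtain ⟨x', hx', -⟩ := hmk q
    exact ⟨x - x', by rw [map_sub, hx, hx']⟩
  let E : ℤ × ℤ ≃+ K0 PenroseAlgebra := AddEquiv.ofBijective J ⟨hinj, hsurj⟩
  have hE : ∀ x, E x = J x := fun _ => rfl
  refine ⟨E.symm, ?_, ?_, ?_⟩
  · rw [AddEquiv.symm_apply_eq, hE, hJ, one_smul, zero_smul, add_zero]
  · rw [AddEquiv.symm_apply_eq, hE, hJ, one_smul, zero_smul, zero_add]
  · ext x
    change _ ↔ 0 ≤ Real.goldenRatio * (x.1 : ℝ) + x.2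
    constructor
    · rintro ⟨_, ⟨v, rfl⟩, rfl⟩
      obtain ⟨p, rfl⟩ := Quotient.exists_rep v
      obtain ⟨x, hx, hx0⟩ := hmk p
      have h : E.symm (K0.mk p) = x := by rw [AddEquiv.symm_apply_eq, hE, hx]
      rw [← h] at hx0
      exact hx0
    · intro hx
      obtain ⟨v, hv⟩ := Penrose.exists_trace_eq hcomm hT hx
      refine ⟨_, ⟨v, rfl⟩, ?_⟩
      rw [AddEquiv.symm_apply_eq, hE]
      -- The projector class found has the same trace as `J x`, so injectivity puts `J x` in the
      -- positive cone.
      refine Penrose.trace_K0_injective hcomm hT ?_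
      rw [hTJ, K0.trace_of, hv]
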